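/- Model ($\mathrm{KT}_1$ LOCAL). The network is an undirected graph $G=(V,E)$ with $n=|V|\ge 2$ nodes carrying arbitrary distinct identifiers from $\mathbb{N}$. All nodes run the same algorithm in synchronous rounds; in each round a node may send one message of unbounded size to each of its neighbors, receives the messages sent to it in that round, and performs arbitrary local computation. Initially a node knows only $n$, $\kappa$, $W$, its own identifier, the identifiers of its neighbors, and its own random seed, which is independent of the seeds of the other nodes. A node terminates when it produces its output, and then sends no further messages. The round complexity is the number of rounds until all nodes have terminated; the message complexity is the total number of messages sent. Let $\kappa, W\ge 1$ be integers. A sparse $(\kappa,W)$-neighborhood cover of $G$ is a finite collection $\mathcal{C}$ of rooted trees (clusters) that are subgraphs of $G$ such that: every $\tau\in\mathcal{C}$ has depth $O(\kappa W)$; every vertex is contained in $O(\kappa\, n^{1/\kappa}\log n)$ of the trees; and for every vertex $v$ some $\tau\in\mathcal{C}$ contains all vertices at distance at most $W$ from $v$ in $G$. It is constructed when every node outputs the names of the clusters containing it and, for each of these, the identifiers of its parent (none, if it is the root) and of its children in the cluster tree. Lemma. For every constant $c\in\mathbb{N}$ there is a randomized distributed (Monte Carlo) algorithm in the $\mathrm{KT}_1$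 LOCAL model that, for all $n$, $\kappa$, $W$ and $G$ as above, always terminates within $O(\kappa^3W^2)$ rounds and, with probability at least $1-n^{-c}$, constructs a sparse $(\kappa,W)$-neighborhood cover of $G$ and sends $O(n\cdot\kappa\cdot n^{1/\kappa}\log n\cdot\kappa W)$ messages in total. All the hidden constants depend only on $c$. -/

import Mathlib

open MeasureTheory
open scoped ENNReal unitInterval

universe u

noncomputable section

/-! ### Sparse neighborhood covers -/

/-- A cluster of a graph `G`: a rooted tree which is a subgraph of `G`. -/
structure Cluster {V : Type u} (G : SimpleGraph V) where
  tree : G.Subgraph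
  isTree : tree.coe.IsTree
  root : tree.verts

namespace Cluster

variable {V : Type u} {G : SimpleGraph V}

/-- The depth of a (finite) cluster: the largest distance, in the tree, from the root. -/
def depth (τ : Cluster G) : ℕ :=
  ⨆ v : τ.tree.verts, τ.tree.coe.dist τ.root v

/-- `p` is the parent of `v` in the rooted tree `τ`: they are adjacent in the tree, and `v` is
one step further away from the root than `p`. -/
def IsParent (τ : Cluster G) (p v : V) : Prop :=
  ∃ (hp : p ∈ τ.tree.verts) (hv : v ∈ τ.tree.verts), τ.tree.Adj p v ∧
    τ.tree.coe.dist τ.root ⟨v, hv⟩ = τ.tree.coe.dist τ.root ⟨p, hp⟩ + 1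

end Cluster

/-- The finite family `𝒞` of clusters of `G` is a sparse `(κ, W)`-neighborhood cover, where the
constant hidden in the asymptotic bounds on depth and sparsity is `C`. -/
structure IsSparseNeighborhoodCover {V : Type u} [Fintype V] {G : SimpleGraph V}
    {ι : Type} [Fintype ι] (C : ℝ) (κ W : ℕ) (𝒞 : ι → Cluster G) : Prop where
  depth_le : ∀ i, ((𝒞 i).depth : ℝ) ≤ C * (W * κ)
  sparsity : ∀ v : V, ({i | v ∈ (𝒞 i).tree.verts}.ncard : ℝ) ≤
    C * (κ * (Fintype.card V : ℝ) ^ (1 / (κ : ℝ)) * Real.log (Fintype.card V))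
  neighborhood : ∀ v : V, ∃ i, ∀ w : V, G.edist v w ≤ W → w ∈ (𝒞 i).tree.verts

/-! ### The synchronous `KT₁` LOCAL model -/

/-- A communication network: an undirected graph whose nodes carry distinct identifiers. -/
structure Network (V : Type u) where
  graph : SimpleGraph V
  ident : V ↪ ℕ

/-- What a node knows at the beginning: the number `n` of nodes and the parameters `κ` and `W`,
its own identifier, the identifiers of its neighbors, and its private random seed, a uniformly
random number in `[0, 1]` (whose binary digits are an infinite sequence of fair coin flips). -/
structure LocalInput where
  n : ℕ
  κ : ℕ
  W : ℕ
  ident : ℕ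
  nbrs : Finset ℕ
  seed : I

/-- What a node produces: the (names of the) clusters that it belongs to and, for each of them, the
identifiers of its parent (`none` at the root) and of its children in the cluster tree. -/
structure LocalOutput where
  clusters : Finset ℕ
  parent : ℕ → Option ℕ
  children : ℕ → Finset ℕ

/-- A distributed algorithm: all nodes run the same code. Messages are elements of an arbitrary
type, so their size is not restricted, and local computation is arbitrary. -/
structure DistAlgorithm where
  State : Type
  Msg : Type
  /-- the initial state -/
  start : LocalInput → State
  /-- the message (if any) sent in the current round to the neighbor with the given identifier -/
  send : State → ℕ → Option Msg
  /-- the new state, from the messages received, indexed by the identifiers of their senders -/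
  update : State → (ℕ → Option Msg) → State
  /-- the output; a node that produces one has terminated -/
  output : State → Option LocalOutput

namespace DistAlgorithm

variable {V : Type u} [Fintype V]

/-- The message actually sent: a node that has terminated sends nothing. -/
def emit (A : DistAlgorithm) (s : A.State) (x : ℕ) : Option A.Msg :=
  if (A.output s).isSome then none else A.send s x

open Classical in
/-- The messages received by `v` in a round at whose beginning the nodes are in the states `s`:
the identifier `x` is mapped to the message of the neighbor of `v` whose identifier is `x`. -/
def inbox (A : DistAlgorithm) (N : Network V) (s : V → A.State) (v : V) (x : ℕ) : Option A.Msg :=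
  if h : ∃ w, N.graph.Adj v w ∧ N.ident w = x then A.emit (s h.choose) (N.ident v) else none

open Classical in
/-- The initial knowledge of `v` in the `KT₁` model, when its private random seed is `r`. -/
def localInput (N : Network V) (κ W : ℕ) (r : I) (v : V) : LocalInput where
  n := Fintype.card V
  κ := κ
  W := W
  ident := N.ident v
  nbrs := (Finset.univ.filter fun w => N.graph.Adj v w).image N.ident
  seed := r

/-- The states of the nodes after `t` rounds, when the random seeds are `ω`. A node that has
terminated does not change its state. -/
def run (A : DistAlgorithm) (N : Network V) (κ W : ℕ) (ω : V → I) : ℕ → V → A.State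
  | 0 => fun v => A.start (localInput N κ W (ω v) v)
  | t + 1 => fun v =>
      if (A.output (A.run N κ W ω t v)).isSome then A.run N κ W ω t v
      else A.update (A.run N κ W ω t v) (A.inbox N (A.run N κ W ω t) v)

open Classical in
/-- The number of messages sent by all nodes in the round that starts in the states `s`. -/
def roundMessages (A : DistAlgorithm) (N : Network V) (s : V → A.State) : ℕ :=
  Finset.card {p : V × V | N.graph.Adj p.1 p.2 ∧ (A.emit (s p.1) (N.ident p.2)).isSome}

/-- The total number of messages sent by all nodes in the first `T` rounds. -/
def messages (A : DistAlgorithm) (N : Network V) (κ W : ℕ) (ω : V → I) (T : ℕ) : ℕ :=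
  ∑ t ∈ Finset.range T, A.roundMessages N (A.run N κ W ω t)

/-- All nodes have terminated within `T` rounds. -/
def TerminatesBy (A : DistAlgorithm) (N : Network V) (κ W : ℕ) (ω : V → I) (T : ℕ) : Prop :=
  ∀ v, (A.output (A.run N κ W ω T v)).isSome

end DistAlgorithm

/-- The outputs `out` of the nodes are a distributed representation of the family `𝒞` of clusters,
which are named by the elements of `L`: every node knows the clusters that it belongs to, and its
parent and its children in each of their trees. -/
structure Represents {V : Type u} (N : Network V) (out : V → LocalOutput)
    (L : Finset ℕ) (𝒞 : L → Cluster N.graph) : Prop where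
  mem_clusters : ∀ v l, l ∈ (out v).clusters ↔ ∃ h : l ∈ L, v ∈ (𝒞 ⟨l, h⟩).tree.verts
  parent_eq : ∀ (i : L) (v : V), v ∈ (𝒞 i).tree.verts → ∀ x,
    (out v).parent i = some x ↔ ∃ p, N.ident p = x ∧ (𝒞 i).IsParent p v
  mem_children : ∀ (i : L) (v : V), v ∈ (𝒞 i).tree.verts → ∀ x,
    x ∈ (out v).children i ↔ ∃ w, N.ident w = x ∧ (𝒞 i).IsParent v w

/-- After `T` rounds all nodes have terminated, and their outputs represent a sparse
`(κ, W)`-neighborhood cover of the network (with constant `C`). -/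
def DistAlgorithm.ConstructsCover {V : Type u} [Fintype V] (A : DistAlgorithm) (N : Network V)
    (C : ℝ) (κ W : ℕ) (ω : V → I) (T : ℕ) : Prop :=
  ∃ (out : V → LocalOutput) (L : Finset ℕ) (𝒞 : L → Cluster N.graph),
    (∀ v, A.output (A.run N κ W ω T v) = some (out v)) ∧
    Represents N out L 𝒞 ∧ IsSparseNeighborhoodCover C κ W 𝒞

end

/-! Every node `u` emits a wave at a random time: a fixed cap minus a truncated geometric variable
of ratio q = n^(-1/Θ(κW)). A node joins the cluster of `u` if this wave arrives at most 2W after the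
first one. Shortest paths from the root to members stay inside the cluster, so clusters carry BFS
trees of depth O(κW). By the triangle inequality, the W-ball around v lies in the cluster whose wave
reaches v first (`Wave.exists_ball_member`).

Sparsity comes from memorylessness. Fix the time a of the first arrival at w. Given that a wave
arrives by a + 2W + 2, it arrives before a with probability at least q^(2W+3) ≥ 1/(2n^(1/κ)),
independently for different waves. Hence it is unlikely that Θ(n^(1/κ) log n) waves come that soon
but none before a (`volume_many_le_none_le`), and a union bound over w and a gives
`volume_not_sparse_le`. Replacing κ and W by their minima with n keeps the number of values of a
polynomial in n; it is harmless because finite distances are below n and n^(1/n) ≤ 2.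

To save messages, one unit of wave time is simulated by a phase. Members first invite new nodes;
then each cluster collects its reports at the root and sends them down again. With the neighbor
identifiers in the reports, all members know the cluster and its boundary, so a boundary node
receives at most one invitation per cluster instead of one per edge (`Evolves.sound_and_complete`,
`Evolves.card_sends_le`). Only sparsity is random: running time, depth and ball containment are
deterministic. -/

noncomputable section

/-! ### Trees given by parent functions -/

/-- A graph whose edges join the vertices other than `r` to their parents is a tree. -/
theorem SimpleGraph.isTree_of_parent {S : Type*} [Finite S] (H : SimpleGraph S) (r : S)
    (dep : S → ℕ) (par : S → S)
    (hpar : ∀ v, v ≠ r → H.Adj (par v) v ∧ dep (par v) + 1 = dep v)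
    (hadj : ∀ x y, H.Adj x y → (x ≠ r ∧ par x = y) ∨ (y ≠ r ∧ par y = x)) :
    H.IsTree := by
  have hreach : ∀ m v, dep v = m → H.Reachable r v := by
    intro m
    induction m using Nat.strong_induction_on with
    | _ m ih =>
      intro v hv
      by_cases hvr : v = r
      · subst hvr; exact SimpleGraph.Reachable.refl _
      · obtain ⟨h1, h2⟩ := hpar v hvr
        exact (ih (dep (par v)) (by omega) _ rfl).trans h1.reachable
  have hconn : H.Connected := by
    have : Nonempty S := ⟨r⟩
    exact ⟨fun x y => (hreach _ x rfl).symm.trans (hreach _ y rfl)⟩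
  refine SimpleGraph.isTree_iff_connected_and_card.2 ⟨hconn, le_antisymm ?_ ?_⟩
  -- Sending a non-root vertex to the edge to its parent is onto the edges; connectedness gives the
  -- reverse bound.
  · have h1 : Nat.card H.edgeSet ≤ Nat.card {v : S // v ≠ r} := by
      refine Nat.card_le_card_of_surjective
        (fun v : {v : S // v ≠ r} => (⟨s(par v, v), (hpar v.1 v.2).1⟩ : H.edgeSet)) ?_
      rintro ⟨e, he⟩
      induction e with
      | _ x y =>
        rcases hadj x y he with ⟨h, h'⟩ | ⟨h, h'⟩
        · exact ⟨⟨x, h⟩, Subtype.ext (by simp only [h']; exact Sym2.eq_swap)⟩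
        · exact ⟨⟨y, h⟩, Subtype.ext (by simp only [h'])⟩
    have h2 : Nat.card {v : S // v ≠ r} + 1 = Nat.card S := by
      have h3 := Set.ncard_add_ncard_compl ({r} : Set S)
      rw [Set.ncard_singleton] at h3
      have h4 : Nat.card {v : S // v ≠ r} = ({r}ᶜ : Set S).ncard := rfl
      omega
    omega
  · exact hconn.card_vert_le_card_edgeSet_add_one

/-- In a tree given by a parent function, the distance from the root is the depth. -/
theorem SimpleGraph.dist_eq_of_parent {S : Type*} [Finite S] (H : SimpleGraph S) (r : S)
    (dep : S → ℕ) (par : S → S) (hr : dep r = 0)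
    (hpar : ∀ v, v ≠ r → H.Adj (par v) v ∧ dep (par v) + 1 = dep v)
    (hadj : ∀ x y, H.Adj x y → (x ≠ r ∧ par x = y) ∨ (y ≠ r ∧ par y = x)) (v : S) :
    H.dist r v = dep v := by
  have hconn := (H.isTree_of_parent r dep par hpar hadj).connected
  apply le_antisymm
  · have : ∀ m v, dep v = m → H.dist r v ≤ m := by
      intro m
      induction m with
      | zero =>
        intro v hv
        by_cases hvr : v = r
        · subst hvr; simp
        · have := (hpar v hvr).2; omega
      | succ m ih =>
        intro v hv
        by_cases hvr : v = r
        · subst hvr; simp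
        · obtain ⟨h1, h2⟩ := hpar v hvr
          have h3 := ih (par v) (by omega)
          have h4 := hconn.dist_triangle (u := r) (v := par v) (w := v)
          have h5 := SimpleGraph.dist_eq_one_iff_adj.2 h1
          omega
    exact this _ v rfl
  -- Depth changes by exactly one along an edge, so no walk from the root is shorter than the depth
  -- of its end.
  · have hlip : ∀ x y (p : H.Walk x y), dep y ≤ dep x + p.length := by
      intro x y p
      induction p with
      | nil => simp
      | cons h p ih =>
        rw [SimpleGraph.Walk.length_cons]
        rcases hadj _ _ h with ⟨h1, h2⟩ | ⟨h1, h2⟩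
        · have := (hpar _ h1).2; rw [h2] at this; omega
        · have := (hpar _ h1).2; rw [h2] at this; omega
    obtain ⟨p, hp⟩ := hconn.exists_walk_length_eq_dist r v
    have := hlip r v p
    omega

/-! ### A tail bound for independent uniform seeds -/

/-- If every threshold `r u` is at least the fraction `ρ` of `p u`, it is unlikely that many
independent uniform seeds are below the thresholds `p`, but none is below the thresholds `r`. -/
theorem volume_many_le_none_le {V : Type u} [Fintype V] (p r : V → ℝ) (ρ : ℝ)
    (hρ0 : 0 ≤ ρ) (hρ : ρ ≤ 1)
    (hp1 : ∀ u, p u ≤ 1) (hr0 : ∀ u, 0 ≤ r u) (hrp : ∀ u, r u ≤ p u)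
    (hρr : ∀ u, ρ * p u ≤ r u) (k : ℕ) :
    (volume : Measure (V → I))
      {ω | k ≤ {u | (ω u : ℝ) ≤ p u}.ncard ∧ ∀ u, r u < (ω u : ℝ)} ≤
      ENNReal.ofReal ((1 - ρ) ^ k) := by
  classical
  -- The event is cut up according to the set `A` of nodes with seed below `p`; each piece lies in a
  -- box, whose measure is a product by independence.
  let box : Finset V → V → Set I := fun A u =>
    if u ∈ A then {x : I | r u < (x : ℝ) ∧ (x : ℝ) ≤ p u} else {x : I | p u < (x : ℝ)}
  have hsub : {ω : V → I | k ≤ {u | (ω u : ℝ) ≤ p u}.ncard ∧ ∀ u, r u < (ω u : ℝ)} ⊆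
      ⋃ A ∈ Finset.univ.powerset.filter (fun A : Finset V => k ≤ A.card),
        Set.pi Set.univ (box A) := by
    rintro ω ⟨h1, h2⟩
    simp only [Set.mem_iUnion]
    refine ⟨Finset.univ.filter (fun u => (ω u : ℝ) ≤ p u), ?_, ?_⟩
    · simp only [Finset.mem_filter, Finset.mem_powerset, Finset.subset_univ, true_and]
      rwa [← Set.ncard_coe_finset, Finset.coe_filter_univ]
    · intro u _
      by_cases h : (ω u : ℝ) ≤ p u
      · simp [box, h, h2 u]
      · simpa [box, h] using lt_of_not_ge h
  have himg : ∀ a b : ℝ, 0 ≤ a → b ≤ 1 →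
      (volume : Measure I) {x : I | a < (x : ℝ) ∧ (x : ℝ) ≤ b} = ENNReal.ofReal (b - a) := by
    intro a b ha hb
    rw [unitInterval.volume_apply]
    have : Subtype.val '' {x : I | a < (x : ℝ) ∧ (x : ℝ) ≤ b} = Set.Ioc a b := by
      ext x
      constructor
      · rintro ⟨y, hy, rfl⟩; exact hy
      · intro hx; exact ⟨⟨x, by linarith [hx.1], by linarith [hx.2]⟩, hx, rfl⟩
    rw [this, Real.volume_Ioc]
  have hp0 : ∀ u, 0 ≤ p u := fun u => (hr0 u).trans (hrp u)
  have hbox : ∀ A u, (volume : Measure I) (box A u) =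
      ENNReal.ofReal (if u ∈ A then p u - r u else 1 - p u) := by
    intro A u
    by_cases h : u ∈ A
    · simp only [box, h, if_true]; exact himg _ _ (hr0 u) (hp1 u)
    · simp only [box, h, if_false]
      rw [← himg _ _ (hp0 u) le_rfl]
      congr 1
      ext x
      exact ⟨fun hx => ⟨hx, x.2.2⟩, fun hx => hx.1⟩
  have hpi : ∀ A : Finset V, (volume : Measure (V → I)) (Set.pi Set.univ (box A)) =
      ENNReal.ofReal (∏ u, if u ∈ A then p u - r u else 1 - p u) := by
    intro A
    rw [volume_pi_pi, ENNReal.ofReal_prod_of_nonneg]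
    · exact Finset.prod_congr rfl fun u _ => hbox A u
    · intro u _
      split_ifs
      · linarith [hrp u]
      · linarith [hp1 u]
  have hsplit : ∀ (A : Finset V) (f g : V → ℝ), (∏ u, if u ∈ A then f u else g u) =
      (∏ u ∈ A, f u) * ∏ u ∈ Finset.univ \ A, g u := by
    intro A f g
    rw [Finset.prod_ite]
    congr 1
    · exact Finset.prod_congr (by ext; simp) fun _ _ => rfl
    · exact Finset.prod_congr (by ext; simp) fun _ _ => rfl
  calc _ ≤ _ := measure_mono hsub
    _ ≤ ∑ A ∈ Finset.univ.powerset.filter (fun A : Finset V => k ≤ A.card),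
        (volume : Measure (V → I)) (Set.pi Set.univ (box A)) := measure_biUnion_finset_le _ _
    _ = ENNReal.ofReal (∑ A ∈ Finset.univ.powerset.filter (fun A : Finset V => k ≤ A.card),
          ∏ u, if u ∈ A then p u - r u else 1 - p u) := by
        rw [ENNReal.ofReal_sum_of_nonneg]
        · exact Finset.sum_congr rfl fun A _ => hpi A
        · intro A _
          refine Finset.prod_nonneg fun u _ => ?_
          split_ifs
          · linarith [hrp u]
          · linarith [hp1 u]
    _ ≤ _ := by
        apply ENNReal.ofReal_le_ofReal
        have h0 : (0 : ℝ) ≤ 1 - ρ := by linarith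
        calc _ ≤ ∑ A ∈ Finset.univ.powerset.filter (fun A : Finset V => k ≤ A.card),
              (1 - ρ) ^ k * ((∏ u ∈ A, p u) * ∏ u ∈ Finset.univ \ A, (1 - p u)) := by
              refine Finset.sum_le_sum fun A hA => ?_
              have hk : k ≤ A.card := (Finset.mem_filter.1 hA).2
              rw [hsplit, ← mul_assoc]
              refine mul_le_mul_of_nonneg_right ?_
                (Finset.prod_nonneg fun u _ => by linarith [hp1 u])
              calc ∏ u ∈ A, (p u - r u) ≤ ∏ u ∈ A, ((1 - ρ) * p u) :=
                    Finset.prod_le_prod (fun u _ => by linarith [hrp u])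
                      (fun u _ => by linarith [hρr u])
                _ = (1 - ρ) ^ A.card * ∏ u ∈ A, p u := by
                    rw [Finset.prod_mul_distrib, Finset.prod_const]
                _ ≤ (1 - ρ) ^ k * ∏ u ∈ A, p u := by
                    refine mul_le_mul_of_nonneg_right ?_ (Finset.prod_nonneg fun u _ => hp0 u)
                    exact pow_le_pow_of_le_one h0 (by linarith) hk
          _ ≤ ∑ A ∈ Finset.univ.powerset,
              (1 - ρ) ^ k * ((∏ u ∈ A, p u) * ∏ u ∈ Finset.univ \ A, (1 - p u)) := by
              refine Finset.sum_le_sum_of_subset_of_nonneg (Finset.filter_subset _ _) ?_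
              intro A _ _
              exact mul_nonneg (pow_nonneg h0 _) (mul_nonneg
                (Finset.prod_nonneg fun u _ => hp0 u)
                (Finset.prod_nonneg fun u _ => by linarith [hp1 u]))
          -- Without the restriction on `A.card`, the weights add up to `∏ u, (p u + (1 - p u)) =
          -- 1`.
          _ = (1 - ρ) ^ k := by
              rw [← Finset.mul_sum, ← Finset.prod_add]
              simp

/-! ### Waves -/

/-- Every node `u` of a network emits a wave at time `delay u`, which moves at unit speed. A node
joins the cluster of `u` if this wave arrives at most `slack` after the first one. -/
structure Wave (V : Type u) where
  net : Network V
  delay : V → ℕ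
  cap : ℕ
  slack : ℕ
  delay_le : ∀ u, delay u ≤ cap

namespace Wave

variable {V : Type u} (P : Wave V)

/-- The time by which every node has joined all its clusters. -/
def horizon : ℕ := P.cap + P.slack

open Classical in
/-- The distance of `w` from `u`, with a large value for nodes in different components. -/
def hop (u w : V) : ℕ :=
  -- The value `horizon + 1` is too large for a member, so unreachable nodes never join; being
  -- constant outside the component of `u`, it keeps `hop` 1-Lipschitz along edges.
  if P.net.graph.Reachable u w then P.net.graph.dist u w else P.horizon + 1

/-- The time of arrival at `w` of the wave of `u`. -/
def arrival (u w : V) : ℕ := P.delay u + P.hop u w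

/-- The time of arrival at `w` of the first wave. -/
def first (w : V) : ℕ := ⨅ u, P.arrival u w

/-- `w` joins the cluster of `u`. -/
def Member (u w : V) : Prop := P.arrival u w ≤ P.first w + P.slack

/-- `x` precedes `w` on a shortest path from `u`. -/
def Pred (u w x : V) : Prop := P.net.graph.Adj x w ∧ P.hop u x + 1 = P.hop u w

open Classical in
/-- The parent of `w` in the cluster of `u`. -/
def par (u w : V) : V :=
  -- Ties are broken by the least identifier, in agreement with `Invites`; the fallback `w` never
  -- occurs at a member other than `u`.
  if h : ∃ x, P.Pred u w x ∧ ∀ y, P.Pred u w y → P.net.ident x ≤ P.net.ident y then h.choose else w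

@[simp] theorem hop_self (u : V) : P.hop u u = 0 := by simp [hop]

theorem hop_adj {u x w : V} (h : P.net.graph.Adj x w) : P.hop u w ≤ P.hop u x + 1 := by
  unfold hop
  by_cases hx : P.net.graph.Reachable u x
  · rw [if_pos hx, if_pos (hx.trans h.reachable)]
    obtain ⟨p, hp⟩ := hx.exists_walk_length_eq_dist
    have := SimpleGraph.dist_le (p.concat h)
    rw [SimpleGraph.Walk.length_concat] at this
    omega
  · rw [if_neg hx, if_neg fun hw => hx (hw.trans h.symm.reachable)]
    omega

theorem hop_le_of_walk {u x w : V} (p : P.net.graph.Walk x w) :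
    P.hop u w ≤ P.hop u x + p.length := by
  induction p with
  | nil => simp
  | cons h p ih =>
    rw [SimpleGraph.Walk.length_cons]
    have := P.hop_adj (u := u) h
    omega

theorem hop_le_of_edist_le {u v w : V} {m : ℕ} (h : P.net.graph.edist v w ≤ m) :
    P.hop u w ≤ P.hop u v + m := by
  have hr : P.net.graph.Reachable v w := by
    apply SimpleGraph.edist_ne_top_iff_reachable.1
    intro h'
    rw [h'] at h
    exact absurd h (by simp)
  obtain ⟨p, hp⟩ := hr.exists_walk_length_eq_edist
  have h1 := P.hop_le_of_walk (u := u) p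
  rw [← hp] at h
  have : p.length ≤ m := by exact_mod_cast h
  omega

theorem eq_of_hop_eq_zero {u w : V} (h : P.hop u w = 0) : u = w := by
  unfold hop at h
  split_ifs at h with hr
  exact hr.dist_eq_zero_iff.1 h

theorem exists_pred {u w : V} (h0 : u ≠ w) (h : P.hop u w ≤ P.horizon) : ∃ x, P.Pred u w x := by
  have hr : P.net.graph.Reachable u w := by
    by_contra hr
    rw [hop, if_neg hr] at h
    omega
  obtain ⟨p, hp⟩ := hr.symm.exists_walk_length_eq_dist
  rw [SimpleGraph.dist_comm] at hp
  cases p with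
  | nil => exact absurd rfl h0
  | cons hadj p =>
    rename_i x
    refine ⟨x, hadj.symm, le_antisymm ?_ (P.hop_adj hadj.symm)⟩
    have hx : P.net.graph.Reachable u x := hr.trans hadj.reachable
    have := SimpleGraph.dist_le p
    rw [SimpleGraph.dist_comm] at this
    rw [SimpleGraph.Walk.length_cons] at hp
    rw [hop, hop, if_pos hx, if_pos hr]
    omega

theorem first_le (u w : V) : P.first w ≤ P.arrival u w := ciInf_le' _ _

theorem exists_arrival_eq_first (w : V) : ∃ u, P.arrival u w = P.first w := by
  have : Nonempty V := ⟨w⟩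
  exact ciInf_mem fun u => P.arrival u w

theorem first_le_delay (w : V) : P.first w ≤ P.delay w := by
  simpa [arrival] using P.first_le w w

theorem first_le_cap (w : V) : P.first w ≤ P.cap := (P.first_le_delay w).trans (P.delay_le w)

theorem first_adj {x w : V} (h : P.net.graph.Adj x w) : P.first w ≤ P.first x + 1 := by
  obtain ⟨u, hu⟩ := P.exists_arrival_eq_first x
  have h1 := P.first_le u w
  have h2 := P.hop_adj (u := u) h
  unfold arrival at *
  omega

variable {P}

theorem Member.arrival_le {u w : V} (h : P.Member u w) : P.arrival u w ≤ P.horizon := by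
  have := P.first_le_cap w
  unfold Member at h
  unfold horizon
  omega

theorem Member.hop_le {u w : V} (h : P.Member u w) : P.hop u w ≤ P.horizon := by
  have := h.arrival_le
  unfold arrival at this
  omega

/-- One step back towards `u`, the arrival time of its wave drops by one and that of the first wave
by at most one. -/
theorem Member.of_pred {u w x : V} (h : P.Member u w) (hx : P.Pred u w x) : P.Member u x := by
  have h1 := P.first_adj hx.1
  have h2 := hx.2
  unfold Member arrival at *
  omega

theorem Member.root {u w : V} (h : P.Member u w) : P.Member u u := by
  have : ∀ m w, P.hop u w = m → P.Member u w → P.Member u u := by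
    intro m
    induction m with
    | zero =>
      intro w hw h
      have := P.eq_of_hop_eq_zero hw
      rwa [← this] at h
    | succ m ih =>
      intro w hw h
      have hne : u ≠ w := by rintro rfl; simp at hw
      obtain ⟨x, hx⟩ := P.exists_pred hne h.hop_le
      exact ih x (by have := hx.2; omega) (h.of_pred hx)
  exact this _ w rfl h

theorem member_of_arrival_eq_first {u w : V} (h : P.arrival u w = P.first w) : P.Member u w := by
  unfold Member
  omega

variable (P) in
/-- The ball around `v` is contained in the cluster of the node whose wave arrives first. -/
theorem exists_ball_member (v : V) {m : ℕ} (hm : 2 * m ≤ P.slack) :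
    ∃ u, ∀ w, P.net.graph.edist v w ≤ m → P.Member u w := by
  obtain ⟨u, hu⟩ := P.exists_arrival_eq_first v
  refine ⟨u, fun w hw => ?_⟩
  -- Following the first wave at `w` to `v` gives `first v ≤ first w + m`; the way from `v` to `w`
  -- costs another `m`.
  obtain ⟨u', hu'⟩ := P.exists_arrival_eq_first w
  have h1 := P.hop_le_of_edist_le (u := u) hw
  rw [SimpleGraph.edist_comm] at hw
  have h2 := P.hop_le_of_edist_le (u := u') hw
  have h3 := P.first_le u' v
  unfold Member arrival at *
  omega

theorem par_spec {u w : V} (hne : u ≠ w) (h : P.Member u w) :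
    P.Pred u w (P.par u w) ∧ ∀ y, P.Pred u w y → P.net.ident (P.par u w) ≤ P.net.ident y := by
  have hex : ∃ x, P.Pred u w x ∧ ∀ y, P.Pred u w y → P.net.ident x ≤ P.net.ident y := by
    have hne' : {x | P.Pred u w x}.Nonempty := P.exists_pred hne h.hop_le
    refine ⟨Function.argminOn P.net.ident _ hne', Function.argminOn_mem P.net.ident _ hne', ?_⟩
    intro y hy
    exact Function.argminOn_le P.net.ident _ hy
  rw [par, dif_pos hex]
  exact hex.choose_spec

theorem Member.par_mem {u w : V} (hne : u ≠ w) (h : P.Member u w) : P.Member u (P.par u w) :=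
  h.of_pred (par_spec hne h).1

/-! ### The cluster trees -/

variable (P) in
/-- The tree of the cluster of `u`: every member but `u` is joined to its parent. -/
def subtree (u : V) : P.net.graph.Subgraph where
  verts := {w | P.Member u w}
  Adj x y := P.Member u x ∧ P.Member u y ∧ ((x ≠ u ∧ P.par u x = y) ∨ (y ≠ u ∧ P.par u y = x))
  adj_sub := by
    rintro x y ⟨hx, hy, ⟨h, rfl⟩ | ⟨h, rfl⟩⟩
    · exact (par_spec h.symm hx).1.1.symm
    · exact (par_spec h.symm hy).1.1
  edge_vert := fun h => h.1
  symm := ⟨fun _ _ h => ⟨h.2.1, h.1, h.2.2.symm⟩⟩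

theorem subtree_parent {u : V} (h : P.Member u u) (v : (P.subtree u).verts)
    (hv : v ≠ ⟨u, h⟩) :
    ∃ hp : P.Member u (P.par u v), (P.subtree u).coe.Adj ⟨P.par u v, hp⟩ v ∧
      P.hop u (P.par u v) + 1 = P.hop u v := by
  have hne : u ≠ v := fun h' => hv (Subtype.ext h'.symm)
  refine ⟨Member.par_mem hne v.2, ?_, (par_spec hne v.2).1.2⟩
  exact ⟨Member.par_mem hne v.2, v.2, Or.inr ⟨hne.symm, rfl⟩⟩

open Classical in
theorem subtree_isTree_and_dist [Finite V] {u : V} (h : P.Member u u) :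
    (P.subtree u).coe.IsTree ∧
      ∀ v : (P.subtree u).verts, (P.subtree u).coe.dist ⟨u, h⟩ v = P.hop u v := by
  let par' : (P.subtree u).verts → (P.subtree u).verts := fun v =>
    if hv : v = ⟨u, h⟩ then v else ⟨P.par u v, (subtree_parent h v hv).1⟩
  have hpar : ∀ v, v ≠ ⟨u, h⟩ → (P.subtree u).coe.Adj (par' v) v ∧
      P.hop u (par' v) + 1 = P.hop u v := by
    intro v hv
    simp only [par', dif_neg hv]
    exact (subtree_parent h v hv).2
  have hadj : ∀ x y, (P.subtree u).coe.Adj x y →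
      (x ≠ ⟨u, h⟩ ∧ par' x = y) ∨ (y ≠ ⟨u, h⟩ ∧ par' y = x) := by
    rintro ⟨x, hx⟩ ⟨y, hy⟩ ⟨-, -, ⟨hne, hp⟩ | ⟨hne, hp⟩⟩
    · have : (⟨x, hx⟩ : (P.subtree u).verts) ≠ ⟨u, h⟩ := fun e => hne (congrArg Subtype.val e)
      exact Or.inl ⟨this, by simp only [par', dif_neg this]; exact Subtype.ext hp⟩
    · have : (⟨y, hy⟩ : (P.subtree u).verts) ≠ ⟨u, h⟩ := fun e => hne (congrArg Subtype.val e)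
      exact Or.inr ⟨this, by simp only [par', dif_neg this]; exact Subtype.ext hp⟩
  let dep : (P.subtree u).verts → ℕ := fun v => P.hop u v
  exact ⟨SimpleGraph.isTree_of_parent _ _ dep par' hpar hadj,
    SimpleGraph.dist_eq_of_parent _ _ dep par' (P.hop_self u) hpar hadj⟩

/-- The cluster of `u`. -/
def cluster [Finite V] {u : V} (h : P.Member u u) : Cluster P.net.graph where
  tree := P.subtree u
  isTree := (subtree_isTree_and_dist h).1
  root := ⟨u, h⟩

theorem cluster_depth_le [Finite V] {u : V} (h : P.Member u u) :
    (cluster h).depth ≤ P.horizon := by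
  have : Nonempty (cluster h).tree.verts := ⟨(cluster h).root⟩
  refine ciSup_le fun v => ?_
  rw [show (cluster h).tree.coe.dist (cluster h).root v = P.hop u v from
    (subtree_isTree_and_dist h).2 v]
  exact Member.hop_le v.2

/-- The tree distance from the root is `hop`, so only one orientation of a tree edge, the one given
by `par`, leads away from the root. -/
theorem isParent_cluster_iff [Finite V] {u : V} (h : P.Member u u) (p v : V) :
    (cluster h).IsParent p v ↔ P.Member u v ∧ u ≠ v ∧ P.par u v = p := by
  have hd := (subtree_isTree_and_dist h).2
  constructor
  · rintro ⟨hp, hv, hadj, hdist⟩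
    have hdist' : P.hop u v = P.hop u p + 1 := by
      have h1 := hd ⟨v, hv⟩
      have h2 := hd ⟨p, hp⟩
      have h3 : (P.subtree u).coe.dist ⟨u, h⟩ ⟨v, hv⟩ =
        (P.subtree u).coe.dist ⟨u, h⟩ ⟨p, hp⟩ + 1 := hdist
      rw [h1, h2] at h3
      exact h3
    obtain ⟨h1, h2, ⟨h3, h4⟩ | ⟨h3, h4⟩⟩ := hadj
    · have := (par_spec h3.symm h1).1.2
      rw [h4] at this
      omega
    · exact ⟨h2, h3.symm, h4⟩
  · rintro ⟨hv, hne, rfl⟩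
    have hp := Member.par_mem hne hv
    refine ⟨hp, hv, ⟨hp, hv, Or.inr ⟨hne.symm, rfl⟩⟩, ?_⟩
    have h3 : (P.subtree u).coe.dist ⟨u, h⟩ ⟨v, hv⟩ =
        (P.subtree u).coe.dist ⟨u, h⟩ ⟨P.par u v, hp⟩ + 1 := by
      rw [hd, hd]
      exact ((par_spec hne hv).1.2).symm
    exact h3

end Wave

/-! ### The distributed algorithm -/

/-- The report that `node` has joined the cluster of `root`. -/
structure Report where
  root : ℕ
  node : ℕ
  time : ℕ
  depth : ℕ
  parent : Option ℕ
  nbrs : Finset ℕ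

/-- In the light of the reports `R`, the node that made the report `f` in the previous phase has to
invite `x` to the cluster in phase `k`: nobody did so before, and of all the nodes that could do so
now, it has the least identifier. -/
def Invites (R : Set Report) (k : ℕ) (f : Report) (x : ℕ) : Prop :=
  f ∈ R ∧ f.time + 1 = k ∧ x ∈ f.nbrs ∧ ∀ g ∈ R, g.root = f.root →
    g.node ≠ x ∧ (x ∈ g.nbrs → f.time ≤ g.time ∧ f.node ≤ g.node)

/-- The node `me`, which knows the reports `R`, sends them to `x` in slot `j` of phase `k`: in slot
`0`, if it invites `x` to a cluster; in the slots `1, …, H`, if `x` is its parent in a cluster and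
it is the turn of its depth; in the slots `H + 1, …, 2 * H`, if `x` is its child in a cluster and
it is the turn of the depth of `x`. -/
def SendsTo (R : Set Report) (H k j me x : ℕ) : Prop :=
  (j = 0 ∧ ∃ f, Invites R k f x ∧ f.node = me) ∨
  (∃ f ∈ R, f.node = me ∧ f.parent = some x ∧ f.depth + j = H + 1) ∨
  (∃ f ∈ R, f.node = x ∧ f.parent = some me ∧ j = H + f.depth)

/-- The state of a node: its input, the number of the round, and the reports it has received. -/
structure NodeState where
  input : LocalInput
  clock : ℕ
  reports : Set Report

open Classical in
/-- The elements of a finite set of numbers. -/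
def finsetOf (s : Set ℕ) : Finset ℕ := if h : s.Finite then h.toFinset else ∅

theorem mem_finsetOf {s : Set ℕ} (h : s.Finite) (x : ℕ) : x ∈ finsetOf s ↔ x ∈ s := by
  rw [finsetOf, dif_pos h, Set.Finite.mem_toFinset]

open Classical in
/-- The output determined by the reports `R` that the node `me` knows. -/
def outputOf (R : Set Report) (me : ℕ) : LocalOutput where
  clusters := finsetOf {l | ∃ f ∈ R, f.node = me ∧ f.root = l}
  parent l := if h : ∃ x, ∃ f ∈ R, f.root = l ∧ f.node = me ∧ f.parent = some x
    then some h.choose else none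
  children l := finsetOf {x | ∃ f ∈ R, f.root = l ∧ f.node = x ∧ f.parent = some me}

/-- The reports that a node makes about itself in phase `k`, from the messages received. -/
def newReports (slack delay : LocalInput → ℕ) (a : LocalInput) (R : Set Report) (k : ℕ)
    (inbox : ℕ → Option (Set Report)) : Set Report :=
  {g | (∀ h ∈ R, h.node = a.ident → k ≤ h.time + slack a) ∧
    ((delay a = k ∧ g = ⟨a.ident, a.ident, k, 0, none, a.nbrs⟩) ∨
      ∃ x m f, inbox x = some m ∧ f.node = x ∧ Invites m k f a.ident ∧
        g = ⟨f.root, a.ident, k, f.depth + 1, some x, a.nbrs⟩)}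

open Classical in
/-- The message that a node sends to the neighbor `x`. -/
def NodeState.send (H : LocalInput → ℕ) (s : NodeState) (x : ℕ) : Option (Set Report) :=
  if SendsTo s.reports (H s.input) (s.clock / (2 * H s.input + 1))
    (s.clock % (2 * H s.input + 1)) s.input.ident x then some s.reports else none

/-- The state of a node after it has received the messages `inbox`. -/
def NodeState.update (H slack delay : LocalInput → ℕ) (s : NodeState)
    (inbox : ℕ → Option (Set Report)) : NodeState where
  input := s.input
  clock := s.clock + 1
  reports := {g | g ∈ s.reports ∨ (∃ x m, inbox x = some m ∧ g ∈ m) ∨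
    (s.clock % (2 * H s.input + 1) = 0 ∧ g ∈ newReports slack delay s.input s.reports
      (s.clock / (2 * H s.input + 1)) inbox)}

open Classical in
/-- The output of a node, which is produced after `H + 1` phases. -/
def NodeState.output (H : LocalInput → ℕ) (s : NodeState) : Option LocalOutput :=
  if (H s.input + 1) * (2 * H s.input + 1) ≤ s.clock
    then some (outputOf s.reports s.input.ident) else none

/-- The cluster-growing algorithm, which consists of `H + 1` phases of `2 * H + 1` rounds. -/
def waveAlgorithm (H slack delay : LocalInput → ℕ) : DistAlgorithm where
  State := NodeState
  Msg := Set Report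
  start a := ⟨a, 0, ∅⟩
  send := NodeState.send H
  update := NodeState.update H slack delay
  output := NodeState.output H

/-- The state of the node `v` after `t` rounds. -/
def waveRun (H slack delay : LocalInput → ℕ) {V : Type u} [Fintype V] (N : Network V) (κ W : ℕ)
    (ω : V → I) (t : ℕ) (v : V) : NodeState :=
  (waveAlgorithm H slack delay).run N κ W ω t v

theorem DistAlgorithm.inbox_eq_some_iff {V : Type u} [Fintype V] (A : DistAlgorithm)
    (N : Network V) (s : V → A.State) (v : V) (x : ℕ) (m : A.Msg) :
    A.inbox N s v x = some m ↔
      ∃ w, N.graph.Adj v w ∧ N.ident w = x ∧ A.emit (s w) (N.ident v) = some m := by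
  unfold DistAlgorithm.inbox
  constructor
  · intro h
    split_ifs at h with hw
    exact ⟨hw.choose, hw.choose_spec.1, hw.choose_spec.2, h⟩
  · rintro ⟨w, h1, h2, h3⟩
    have hw : ∃ w, N.graph.Adj v w ∧ N.ident w = x := ⟨w, h1, h2⟩
    rw [dif_pos hw]
    have : hw.choose = w := N.ident.injective (hw.choose_spec.2.trans h2.symm)
    rw [this, h3]

/-! ### From the message-passing model to an evolution of sets of reports -/

namespace Wave

variable {V : Type u} [Fintype V] (P : Wave V)

/-- The identifiers of the neighbors of `v`. -/
def nbrIds (v : V) : Finset ℕ := (DistAlgorithm.localInput P.net 0 0 0 v).nbrs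

open Classical in
/-- The report that `w` makes about itself when it joins the cluster of `u`. -/
def report (u w : V) : Report where
  root := P.net.ident u
  node := P.net.ident w
  time := P.arrival u w
  depth := P.hop u w
  parent := if u = w then none else some (P.net.ident (P.par u w))
  nbrs := P.nbrIds w

/-- The number of rounds in a phase. -/
def phase : ℕ := 2 * P.horizon + 1

/-- The number of rounds of the algorithm. -/
def rounds : ℕ := (P.horizon + 1) * P.phase

/-- The report `g` is made by `v` in phase `k`, when the nodes know the reports `R`. -/
def Joins (R : V → Set Report) (k : ℕ) (v : V) (g : Report) : Prop :=
  (∀ h ∈ R v, h.node = P.net.ident v → k ≤ h.time + P.slack) ∧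
  ((P.delay v = k ∧ g = ⟨P.net.ident v, P.net.ident v, k, 0, none, P.nbrIds v⟩) ∨
    ∃ w f, P.net.graph.Adj v w ∧ f.node = P.net.ident w ∧ Invites (R w) k f (P.net.ident v) ∧
      g = ⟨f.root, P.net.ident v, k, f.depth + 1, some (P.net.ident w), P.nbrIds v⟩)

/-- `v` sends a message to `w` in round `t`, when the nodes know the reports `R`. -/
def Sends (R : V → Set Report) (t : ℕ) (v w : V) : Prop :=
  SendsTo (R v) P.horizon (t / P.phase) (t % P.phase) (P.net.ident v) (P.net.ident w)

/-- The family `R t v` of the sets of reports known to `v` after `t` rounds evolves according to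
the algorithm. -/
structure Evolves (R : ℕ → V → Set Report) : Prop where
  zero : ∀ v, R 0 v = ∅
  succ : ∀ t < P.rounds, ∀ v g, g ∈ R (t + 1) v ↔ g ∈ R t v ∨
    (∃ w, P.net.graph.Adj v w ∧ P.Sends (R t) t w v ∧ g ∈ R t w) ∨
    (t % P.phase = 0 ∧ P.Joins (R t) (t / P.phase) v g)

/-- The nodes compute the parameters of the wave `P` from their inputs. -/
structure Computes (H slack delay : LocalInput → ℕ) (κ W : ℕ) (ω : V → I) : Prop where
  horizon_eq : ∀ v, H (DistAlgorithm.localInput P.net κ W (ω v) v) = P.horizon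
  slack_eq : ∀ v, slack (DistAlgorithm.localInput P.net κ W (ω v) v) = P.slack
  delay_eq : ∀ v, delay (DistAlgorithm.localInput P.net κ W (ω v) v) = P.delay v

variable {P} {H slack delay : LocalInput → ℕ} {κ W : ℕ} {ω : V → I}

theorem output_eq (hP : P.Computes H slack delay κ W ω) {s : NodeState} {v : V}
    (h1 : s.input = DistAlgorithm.localInput P.net κ W (ω v) v) :
    s.output H = if P.rounds ≤ s.clock then some (outputOf s.reports (P.net.ident v)) else none := by
  unfold NodeState.output
  rw [h1, hP.horizon_eq]
  rfl

theorem run_succ (hP : P.Computes H slack delay κ W ω) {t : ℕ} (ht : t < P.rounds) {v : V}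
    (h1 : (waveRun H slack delay P.net κ W ω t v).input =
      DistAlgorithm.localInput P.net κ W (ω v) v)
    (h2 : (waveRun H slack delay P.net κ W ω t v).clock = t) :
    waveRun H slack delay P.net κ W ω (t + 1) v =
      (waveRun H slack delay P.net κ W ω t v).update H slack delay
        ((waveAlgorithm H slack delay).inbox P.net (waveRun H slack delay P.net κ W ω t) v) := by
  have h3 := output_eq hP h1
  rw [h2, if_neg (by omega)] at h3
  have h4 : ¬ ((waveRun H slack delay P.net κ W ω t v).output H).isSome = true := by
    rw [h3]; simp
  exact if_neg h4

theorem run_input_clock (hP : P.Computes H slack delay κ W ω) (t : ℕ) (ht : t ≤ P.rounds) (v : V) :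
    (waveRun H slack delay P.net κ W ω t v).input =
      DistAlgorithm.localInput P.net κ W (ω v) v ∧
    (waveRun H slack delay P.net κ W ω t v).clock = t := by
  induction t with
  | zero => exact ⟨rfl, rfl⟩
  | succ t ih =>
    obtain ⟨h1, h2⟩ := ih (by omega)
    rw [run_succ hP (by omega) h1 h2]
    exact ⟨h1, congrArg (· + 1) h2⟩

theorem emit_eq_some_iff (hP : P.Computes H slack delay κ W ω) (t : ℕ) (ht : t < P.rounds)
    (v w : V) (m : Set Report) :
    (waveAlgorithm H slack delay).emit (waveRun H slack delay P.net κ W ω t v) (P.net.ident w) =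
        some m ↔
      P.Sends (fun v => (waveRun H slack delay P.net κ W ω t v).reports) t v w ∧
        (waveRun H slack delay P.net κ W ω t v).reports = m := by
  obtain ⟨h1, h2⟩ := run_input_clock hP t ht.le v
  have h3 := output_eq hP h1
  rw [h2, if_neg (by omega)] at h3
  have h4 : ¬ ((waveRun H slack delay P.net κ W ω t v).output H).isSome = true := by
    rw [h3]; simp
  have h5 : (waveAlgorithm H slack delay).emit (waveRun H slack delay P.net κ W ω t v)
      (P.net.ident w) = (waveRun H slack delay P.net κ W ω t v).send H (P.net.ident w) := if_neg h4
  rw [h5, NodeState.send, h1, h2, hP.horizon_eq]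
  exact Option.ite_none_right_eq_some.trans (and_congr_right fun _ => Option.some_inj)

/-- Before round `rounds` no node has terminated, so every round is a genuine update. The clusters
are analysed through this recursion alone. -/
theorem evolves (hP : P.Computes H slack delay κ W ω) :
    P.Evolves fun t v => (waveRun H slack delay P.net κ W ω t v).reports where
  zero v := rfl
  succ t ht v g := by
    obtain ⟨h1, h2⟩ := run_input_clock hP t ht.le v
    have h5 : ∀ (x : ℕ) (m : Set Report), (waveAlgorithm H slack delay).inbox P.net
        (waveRun H slack delay P.net κ W ω t) v x = some m ↔
        ∃ w, P.net.graph.Adj v w ∧ P.net.ident w = x ∧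
        P.Sends (fun v => (waveRun H slack delay P.net κ W ω t v).reports) t w v ∧
        (waveRun H slack delay P.net κ W ω t w).reports = m := by
      intro x m
      refine (DistAlgorithm.inbox_eq_some_iff (waveAlgorithm H slack delay) _ _ _ _ _).trans ?_
      exact exists_congr fun w => and_congr_right fun _ => and_congr_right fun _ =>
        emit_eq_some_iff hP t ht w v m
    rw [run_succ hP ht h1 h2]
    revert h5
    generalize (waveAlgorithm H slack delay).inbox P.net
          (waveRun H slack delay P.net κ W ω t) v = inb'
    change ℕ → Option (Set Report) at inb'
    obtain ⟨inb, rfl⟩ : ∃ inb : ℕ → Option (Set Report), inb = inb' := ⟨inb', rfl⟩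
    intro h5
    generalize hs : waveRun H slack delay P.net κ W ω t v = s at h1 h2 ⊢
    change g ∈ s.reports ∨ (∃ x m, inb x = some m ∧ g ∈ m) ∨ (_ ∧ _ ∧ (_ ∨ _)) ↔ _
    rw [h1, h2, hP.horizon_eq, hP.slack_eq, hP.delay_eq]
    refine or_congr_right (or_congr ?_ (and_congr_right fun h0 => ?_))
    · constructor
      · rintro ⟨x, m, hx, hg⟩
        obtain ⟨w, h, rfl, hs, rfl⟩ := (h5 _ _).1 hx
        exact ⟨w, h, hs, hg⟩
      · rintro ⟨w, h, hs, hg⟩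
        exact ⟨_, _, (h5 _ _).2 ⟨w, h, rfl, hs, rfl⟩, hg⟩
    · simp only [Joins, hs]
      refine and_congr_right fun _ => or_congr_right ?_
      constructor
      · rintro ⟨x, m, f, hx, h6, h7, h8⟩
        obtain ⟨w, h, rfl, hs, rfl⟩ := (h5 _ _).1 hx
        exact ⟨w, f, h, h6, h7, h8⟩
      · rintro ⟨w, f, h, h6, h7, h8⟩
        -- In slot 0 an inviting node does send to the invited one, by the first clause of
        -- `SendsTo`.
        exact ⟨_, _, f, (h5 _ _).2 ⟨w, h, rfl, Or.inl ⟨h0, f, h7, h6⟩, rfl⟩, h6, h7, h8⟩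

theorem output_run (hP : P.Computes H slack delay κ W ω) (v : V) :
    (waveAlgorithm H slack delay).output
      ((waveAlgorithm H slack delay).run P.net κ W ω P.rounds v) =
    some (outputOf (waveRun H slack delay P.net κ W ω P.rounds v).reports
      (P.net.ident v)) := by
  obtain ⟨h1, h2⟩ := run_input_clock hP P.rounds le_rfl v
  exact (output_eq hP h1).trans (if_pos h2.ge)

end Wave

namespace Wave

variable {V : Type u} {P : Wave V}

/-! ### The reports during the execution -/

theorem slot_eq (k : ℕ) {j : ℕ} (hj : j < P.phase) :
    (k * P.phase + j) / P.phase = k ∧ (k * P.phase + j) % P.phase = j := by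
  have hpos : 0 < P.phase := by omega
  constructor
  · rw [mul_comm, Nat.mul_add_div hpos, Nat.div_eq_of_lt hj, add_zero]
  · rw [mul_comm, Nat.mul_add_mod, Nat.mod_eq_of_lt hj]

theorem slot_lt_rounds {k j : ℕ} (hk : k ≤ P.horizon) (hj : j < P.phase) :
    k * P.phase + j < P.rounds := by
  have : (k + 1) * P.phase ≤ (P.horizon + 1) * P.phase := Nat.mul_le_mul_right _ (by omega)
  unfold rounds
  rw [add_mul] at this
  omega

variable [Fintype V]

theorem mem_nbrIds {v : V} {x : ℕ} :
    x ∈ P.nbrIds v ↔ ∃ w, P.net.graph.Adj v w ∧ P.net.ident w = x := by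
  simp [nbrIds, DistAlgorithm.localInput]

theorem ident_mem_nbrIds {v w : V} : P.net.ident w ∈ P.nbrIds v ↔ P.net.graph.Adj v w := by
  rw [mem_nbrIds]
  constructor
  · rintro ⟨w', h, h'⟩
    rwa [← P.net.ident.injective h']
  · exact fun h => ⟨w, h, rfl⟩

variable (P) in
/-- All reports in `R` are true, and made before phase `k`. -/
def Sound (R : V → Set Report) (k : ℕ) : Prop :=
  ∀ v, ∀ f ∈ R v, ∃ u w, P.Member u w ∧ P.arrival u w < k ∧ f = P.report u w

variable (P) in
/-- The nodes know all the reports that they made before phase `k`. -/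
def Own (R : V → Set Report) (k : ℕ) : Prop :=
  ∀ u v, P.Member u v → P.arrival u v < k → P.report u v ∈ R v

variable (P) in
/-- The nodes know all the reports made before phase `k` in their clusters. -/
def Complete (R : V → Set Report) (k : ℕ) : Prop :=
  ∀ u v w, P.Member u v → P.Member u w → P.arrival u v < k → P.arrival u w < k →
    P.report u w ∈ R v

theorem Complete.own {R : V → Set Report} {k : ℕ} (h : P.Complete R k) : P.Own R k :=
  fun u v hm ha => h u v v hm hm ha ha

theorem parent_report {u w : V} {x : ℕ} :
    (P.report u w).parent = some x ↔ u ≠ w ∧ P.net.ident (P.par u w) = x := by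
  unfold report
  by_cases h : u = w <;> simp [h]

/-- What it means that a report known to a node obliges its author to send an invitation. -/
theorem exists_of_invites {R : V → Set Report} {k : ℕ} (hs : P.Sound R k) {x z : V} {f : Report}
    (hf : f.node = P.net.ident x) (hi : Invites (R x) k f (P.net.ident z)) :
    ∃ u, P.Member u x ∧ P.arrival u x + 1 = k ∧ P.net.graph.Adj x z ∧ f = P.report u x := by
  obtain ⟨h1, h2, h3, -⟩ := hi
  obtain ⟨u, w, hm, ha, rfl⟩ := hs x f h1
  obtain rfl : w = x := P.net.ident.injective hf
  exact ⟨u, hm, h2, ident_mem_nbrIds.1 h3, rfl⟩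

/-- A node that has not seen a wave too long ago joins the cluster of a wave arriving now. -/
theorem le_first_add_slack {R : V → Set Report} {k : ℕ} (ho : P.Own R k) {z : V}
    (hz : ∀ h ∈ R z, h.node = P.net.ident z → k ≤ h.time + P.slack) :
    k ≤ P.first z + P.slack := by
  by_cases hk : k ≤ P.first z
  · omega
  · obtain ⟨u, hu⟩ := P.exists_arrival_eq_first z
    have := hz _ (ho u z (member_of_arrival_eq_first hu) (by omega)) rfl
    change k ≤ P.arrival u z + P.slack at this
    omega

/-- This ties the algorithm to the waves. Completeness lets an inviter see whether `z` has joined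
already and which member has to invite it, so exactly the admissible arrivals at time `k` are
reported, with the parent `par u z`. -/
theorem joins_iff {R : V → Set Report} {k : ℕ} (hs : P.Sound R k) (hc : P.Complete R k)
    (z : V) (g : Report) :
    P.Joins R k z g ↔ ∃ u, P.Member u z ∧ P.arrival u z = k ∧ g = P.report u z := by
  constructor
  · rintro ⟨hz, h⟩
    have hk := le_first_add_slack hc.own hz
    rcases h with ⟨hd, rfl⟩ | ⟨x, f, hadj, hf, hi, rfl⟩
    · have ha : P.arrival z z = k := by simp [arrival, hd]
      refine ⟨z, by unfold Member; omega, ha, ?_⟩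
      simp [report, ha]
    · obtain ⟨u, hmx, hax, -, rfl⟩ := exists_of_invites hs hf hi
      have hle : P.arrival u z ≤ k := by
        have := P.hop_adj (u := u) hadj.symm
        unfold arrival at *
        omega
      have hmz : P.Member u z := by unfold Member; omega
      -- Had the wave reached `z` earlier, the inviter would know the report of `z`, which forbids
      -- the invitation.
      have haz : P.arrival u z = k := by
        by_contra hne
        exact (hi.2.2.2 _ (hc u x z hmx hmz (by omega) (by omega)) rfl).1 rfl
      have hux : u ≠ z := by
        rintro rfl
        have h0 : P.arrival u u ≤ P.arrival u x := by simp [arrival]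
        omega
      have hpx : P.Pred u z x := ⟨hadj.symm, by unfold arrival at *; omega⟩
      obtain ⟨hp, hmin⟩ := par_spec hux hmz
      -- Both are predecessors of `z`; `par` has the least identifier by its definition, and the
      -- inviter `x` by the rule in `Invites`.
      have hpar : P.par u z = x := by
        apply P.net.ident.injective
        apply le_antisymm (hmin x hpx)
        have hmp := Member.par_mem hux hmz
        have hap : P.arrival u (P.par u z) < k := by have := hp.2; unfold arrival at *; omega
        exact ((hi.2.2.2 _ (hc u x _ hmx hmp (by omega) hap) rfl).2
          (ident_mem_nbrIds.2 hp.1)).2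
      refine ⟨u, hmz, haz, ?_⟩
      simp only [report, haz, hpx.2, if_neg hux, hpar]
  · rintro ⟨u, hm, ha, rfl⟩
    refine ⟨?_, ?_⟩
    · intro h hh hn
      obtain ⟨u', w, hm', ha', rfl⟩ := hs z h hh
      obtain rfl : w = z := P.net.ident.injective hn
      have := P.first_le u' w
      unfold Member at hm
      change k ≤ P.arrival u' w + P.slack
      omega
    · by_cases hu : u = z
      · subst hu
        refine Or.inl ⟨by simpa [arrival] using ha, ?_⟩
        simp [report, ha]
      · obtain ⟨hp, hmin⟩ := par_spec hu hm
        have hmp := Member.par_mem hu hm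
        have hap : P.arrival u (P.par u z) + 1 = k := by
          have := hp.2; unfold arrival at *; omega
        refine Or.inr ⟨P.par u z, P.report u (P.par u z), hp.1.symm, rfl, ⟨?_, hap, ?_, ?_⟩, ?_⟩
        · exact hc.own u _ hmp (by omega)
        · exact ident_mem_nbrIds.2 hp.1
        · intro g hg hroot
          obtain ⟨u', y, hmy, hay, rfl⟩ := hs _ g hg
          obtain rfl : u' = u := P.net.ident.injective hroot
          refine ⟨?_, fun hzy => ?_⟩
          · intro hyz
            obtain rfl : y = z := P.net.ident.injective hyz
            omega
          · have hyz : P.net.graph.Adj y z := ident_mem_nbrIds.1 hzy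
            have h1 := P.hop_adj (u := u') hyz
            have h2 : P.arrival u' (P.par u' z) ≤ P.arrival u' y := by unfold arrival at *; omega
            exact ⟨h2, hmin y ⟨hyz, by unfold arrival at *; omega⟩⟩
        · simp only [report, ha, hp.2, if_neg hu]

namespace Evolves

variable {R : ℕ → V → Set Report} (hR : P.Evolves R)
include hR

theorem mono {t : ℕ} (ht : t < P.rounds) {v : V} {g : Report} (hg : g ∈ R t v) :
    g ∈ R (t + 1) v := (hR.succ t ht v g).2 (Or.inl hg)

theorem sound_succ {k j : ℕ} (hk : k ≤ P.horizon) (hj : j < P.phase) (hj0 : j ≠ 0) {m : ℕ}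
    (hs : P.Sound (R (k * P.phase + j)) m) : P.Sound (R (k * P.phase + (j + 1))) m := by
  intro v g hg
  rcases (hR.succ _ (slot_lt_rounds hk hj) v g).1 hg with h | ⟨w, -, -, h⟩ | ⟨h, -⟩
  · exact hs v g h
  · exact hs w g h
  · rw [(slot_eq k hj).2] at h
    exact absurd h hj0

/-- Only slot 0 creates reports. They are guaranteed to be known to their authors only, whence
`Own`; the later slots restore `Complete`. -/
theorem first_slot {k : ℕ} (hk : k ≤ P.horizon) (hs : P.Sound (R (k * P.phase)) k)
    (hc : P.Complete (R (k * P.phase)) k) :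
    P.Sound (R (k * P.phase + 1)) (k + 1) ∧ P.Own (R (k * P.phase + 1)) (k + 1) := by
  have hpos : 0 < P.phase := Nat.succ_pos _
  have hslot := slot_eq (P := P) k hpos
  have ht := slot_lt_rounds hk hpos
  rw [add_zero] at hslot ht
  constructor
  · intro v g hg
    rcases (hR.succ _ ht v g).1 hg with h | ⟨w, -, -, h⟩ | ⟨-, h⟩
    · obtain ⟨u, w, h1, h2, h3⟩ := hs v g h
      exact ⟨u, w, h1, by omega, h3⟩
    · obtain ⟨u, w, h1, h2, h3⟩ := hs w g h
      exact ⟨u, w, h1, by omega, h3⟩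
    · rw [hslot.1, joins_iff hs hc] at h
      obtain ⟨u, h1, h2, h3⟩ := h
      exact ⟨u, v, h1, by omega, h3⟩
  · intro u v hm ha
    by_cases hlt : P.arrival u v < k
    · exact hR.mono ht (hc.own u v hm hlt)
    · refine (hR.succ _ ht v _).2 (Or.inr (Or.inr ⟨hslot.2, ?_⟩))
      rw [hslot.1, joins_iff hs hc]
      exact ⟨u, hm, by omega, rfl⟩

theorem later_slots {k : ℕ} (hk : k ≤ P.horizon)
    (h0 : P.Sound (R (k * P.phase + 1)) (k + 1) ∧ P.Own (R (k * P.phase + 1)) (k + 1)) (j : ℕ)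
    (hj : j < P.phase) :
    P.Sound (R (k * P.phase + (j + 1))) (k + 1) ∧ P.Own (R (k * P.phase + (j + 1))) (k + 1) := by
  induction j with
  | zero => exact h0
  | succ j ih =>
    obtain ⟨h1, h2⟩ := ih (by omega)
    exact ⟨hR.sound_succ hk hj (by omega) h1,
      fun u v hm ha => hR.mono (slot_lt_rounds hk hj) (h2 u v hm ha)⟩

/-- After `j` further slots, every new report has come up to a member at depth at most
`horizon - j`. -/
theorem convergecast {k : ℕ} (hk : k ≤ P.horizon)
    (h0 : P.Sound (R (k * P.phase + 1)) (k + 1) ∧ P.Own (R (k * P.phase + 1)) (k + 1)) (j : ℕ)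
    (hj : j ≤ P.horizon) (u w : V) (hw : P.Member u w) (haw : P.arrival u w < k + 1) :
    ∃ x, P.Member u x ∧ P.arrival u x < k + 1 ∧ P.hop u x + j ≤ P.horizon ∧
      P.report u w ∈ R (k * P.phase + (j + 1)) x := by
  induction j with
  | zero => exact ⟨w, hw, haw, hw.hop_le, h0.2 u w hw haw⟩
  | succ j ih =>
    obtain ⟨x, hx, hax, hd, hr⟩ := ih (by omega)
    have hj' : j + 1 < P.phase := by unfold phase; omega
    have ht := slot_lt_rounds hk hj'
    by_cases hlt : P.hop u x + (j + 1) ≤ P.horizon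
    · exact ⟨x, hx, hax, hlt, hR.mono ht hr⟩
    -- Here `hop u x + j = horizon`, so it is the turn of the depth of `x` to send upwards.
    · have hux : u ≠ x := by rintro rfl; simp at hlt; omega
      obtain ⟨hp, -⟩ := par_spec hux hx
      have hd' := hp.2
      refine ⟨P.par u x, Member.par_mem hux hx, by unfold arrival at *; omega, by omega, ?_⟩
      refine (hR.succ _ ht _ _).2 (Or.inr (Or.inl ⟨x, hp.1, ?_, hr⟩))
      unfold Sends
      rw [(slot_eq k hj').2]
      have hown := (hR.later_slots hk h0 j (by omega)).2 u x hx hax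
      refine Or.inr (Or.inl ⟨_, hown, rfl, parent_report.2 ⟨hux, rfl⟩, ?_⟩)
      change P.hop u x + (j + 1) = P.horizon + 1
      omega

/-- After `horizon + j` further slots, every member at depth at most `j` knows all the reports in
its cluster. -/
theorem broadcast {k : ℕ} (hk : k ≤ P.horizon)
    (h0 : P.Sound (R (k * P.phase + 1)) (k + 1) ∧ P.Own (R (k * P.phase + 1)) (k + 1)) (j : ℕ)
    (hj : j ≤ P.horizon) (u v w : V) (hv : P.Member u v) (hav : P.arrival u v < k + 1)
    (hd : P.hop u v ≤ j) (hw : P.Member u w) (haw : P.arrival u w < k + 1) :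
    P.report u w ∈ R (k * P.phase + (P.horizon + j + 1)) v := by
  induction j generalizing v w with
  | zero =>
    obtain ⟨x, -, -, hdx, hr⟩ := hR.convergecast hk h0 P.horizon le_rfl u w hw haw
    have h1 := P.eq_of_hop_eq_zero (u := u) (w := x) (by omega)
    have h2 := P.eq_of_hop_eq_zero (u := u) (w := v) (by omega)
    rw [← h2]
    rwa [← h1] at hr
  | succ j ih =>
    have hj' : P.horizon + j + 1 < P.phase := by unfold phase; omega
    have ht := slot_lt_rounds hk hj'
    by_cases hle : P.hop u v ≤ j
    · exact hR.mono ht (ih (by omega) v w hv hav hle hw haw)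
    · have huv : u ≠ v := by rintro rfl; simp at hle
      obtain ⟨hp, -⟩ := par_spec huv hv
      have hd' := hp.2
      have hmp := Member.par_mem huv hv
      have hap : P.arrival u (P.par u v) < k + 1 := by unfold arrival at *; omega
      have hdp : P.hop u (P.par u v) ≤ j := by omega
      refine (hR.succ _ ht _ _).2 (Or.inr (Or.inl ⟨P.par u v, hp.1.symm, ?_,
        ih (by omega) _ w hmp hap hdp hw haw⟩))
      unfold Sends
      rw [(slot_eq k hj').2]
      -- The parent knows that `v` is its child because the induction hypothesis also supplies the
      -- report of `v`.
      refine Or.inr (Or.inr ⟨_, ih (by omega) _ v hmp hap hdp hv hav, rfl,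
        parent_report.2 ⟨huv, rfl⟩, ?_⟩)
      change P.horizon + j + 1 = P.horizon + P.hop u v
      omega

/-- The invariant at the start of a phase: slot 0 adds the arrivals of time `k`, then `horizon`
slots up and `horizon` slots down the trees spread them through their clusters. -/
theorem sound_and_complete (k : ℕ) (hk : k ≤ P.horizon + 1) :
    P.Sound (R (k * P.phase)) k ∧ P.Complete (R (k * P.phase)) k := by
  induction k with
  | zero =>
    constructor
    · intro v f hf
      rw [zero_mul, hR.zero] at hf
      exact absurd hf (Set.notMem_empty f)
    · intro u v w _ _ h
      omega
  | succ k ih =>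
    obtain ⟨h1, h2⟩ := ih (by omega)
    have h0 := hR.first_slot (by omega) h1 h2
    have hph : (k + 1) * P.phase = k * P.phase + (P.horizon + P.horizon + 1) := by
      unfold phase; ring
    constructor
    · rw [hph]
      exact (hR.later_slots (by omega) h0 _ (by unfold phase; omega)).1
    · intro u v w hv hw hav haw
      rw [hph]
      exact hR.broadcast (by omega) h0 _ le_rfl u v w hv hav hv.hop_le hw haw

/-- In the end, the nodes know exactly the reports in their clusters. -/
theorem final (v : V) : (∀ f ∈ R P.rounds v, ∃ u w, P.Member u w ∧ f = P.report u w) ∧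
    ∀ u w, P.Member u v → P.Member u w → P.report u w ∈ R P.rounds v := by
  obtain ⟨h1, h2⟩ := hR.sound_and_complete (P.horizon + 1) le_rfl
  constructor
  · intro f hf
    obtain ⟨u, w, hm, -, h⟩ := h1 v f hf
    exact ⟨u, w, hm, h⟩
  · intro u w hv hw
    exact h2 u v w hv hw (Nat.lt_succ_of_le hv.arrival_le) (Nat.lt_succ_of_le hw.arrival_le)

end Evolves
end Wave

namespace Wave

variable {V : Type u} [Fintype V] {P : Wave V}

/-! ### The output of the algorithm -/

namespace Evolves

variable {R : ℕ → V → Set Report} (hR : P.Evolves R)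
include hR

theorem mem_clusters_iff (v : V) (l : ℕ) :
    l ∈ (outputOf (R P.rounds v) (P.net.ident v)).clusters ↔
      ∃ u, P.net.ident u = l ∧ P.Member u v := by
  obtain ⟨h1, h2⟩ := hR.final v
  have hset : ∀ l, (∃ f ∈ R P.rounds v, f.node = P.net.ident v ∧ f.root = l) ↔
      ∃ u, P.net.ident u = l ∧ P.Member u v := by
    intro l
    constructor
    · rintro ⟨f, hf, hn, rfl⟩
      obtain ⟨u, w, hm, rfl⟩ := h1 f hf
      obtain rfl : w = v := P.net.ident.injective hn
      exact ⟨u, rfl, hm⟩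
    · rintro ⟨u, rfl, hm⟩
      exact ⟨_, h2 u v hm hm, rfl, rfl⟩
  refine (mem_finsetOf ?_ l).trans (hset l)
  refine (Set.finite_range P.net.ident).subset fun l hl => ?_
  obtain ⟨u, hu, -⟩ := (hset l).1 hl
  exact ⟨u, hu⟩

theorem parent_eq_some_iff {u v : V} (hm : P.Member u v) (x : ℕ) :
    (outputOf (R P.rounds v) (P.net.ident v)).parent (P.net.ident u) = some x ↔
      u ≠ v ∧ P.net.ident (P.par u v) = x := by
  obtain ⟨h1, h2⟩ := hR.final v
  have hset : ∀ x, (∃ f ∈ R P.rounds v, f.root = P.net.ident u ∧ f.node = P.net.ident v ∧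
      f.parent = some x) ↔ u ≠ v ∧ P.net.ident (P.par u v) = x := by
    intro x
    constructor
    · rintro ⟨f, hf, hr, hn, hp⟩
      obtain ⟨u', w, hm', rfl⟩ := h1 f hf
      obtain rfl : w = v := P.net.ident.injective hn
      obtain rfl : u' = u := P.net.ident.injective hr
      exact parent_report.1 hp
    · intro h
      exact ⟨_, h2 u v hm hm, rfl, rfl, parent_report.2 h⟩
  simp only [outputOf]
  split_ifs with h
  · rw [Option.some_inj]
    have h3 := (hset _).1 h.choose_spec
    constructor
    · intro hx; rwa [hx] at h3
    · intro hx; exact h3.2.symm.trans hx.2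
  · simp only [false_iff]
    exact fun hx => h ⟨x, (hset x).2 hx⟩

theorem mem_children_iff {u v : V} (hm : P.Member u v) (x : ℕ) :
    x ∈ (outputOf (R P.rounds v) (P.net.ident v)).children (P.net.ident u) ↔
      ∃ w, P.net.ident w = x ∧ P.Member u w ∧ u ≠ w ∧ P.par u w = v := by
  obtain ⟨h1, h2⟩ := hR.final v
  have hset : ∀ x, (∃ f ∈ R P.rounds v, f.root = P.net.ident u ∧ f.node = x ∧
      f.parent = some (P.net.ident v)) ↔
      ∃ w, P.net.ident w = x ∧ P.Member u w ∧ u ≠ w ∧ P.par u w = v := by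
    intro x
    constructor
    · rintro ⟨f, hf, hr, rfl, hp⟩
      obtain ⟨u', w, hm', rfl⟩ := h1 f hf
      obtain rfl : u' = u := P.net.ident.injective hr
      obtain ⟨h3, h4⟩ := parent_report.1 hp
      exact ⟨w, rfl, hm', h3, P.net.ident.injective h4⟩
    · rintro ⟨w, rfl, hw, hne, rfl⟩
      exact ⟨_, h2 u w hm hw, rfl, rfl, parent_report.2 ⟨hne, rfl⟩⟩
  refine (mem_finsetOf ?_ x).trans (hset x)
  refine (Set.finite_range P.net.ident).subset fun l hl => ?_
  obtain ⟨u, hu, -⟩ := (hset l).1 hl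
  exact ⟨u, hu⟩

open Classical in
/-- The outputs represent the clusters of the wave. -/
theorem exists_represents (C : ℝ) {κ W : ℕ} (hW : ∀ v w, P.net.graph.edist v w ≤ W →
      P.net.graph.edist v w ≤ (P.slack / 2 : ℕ))
    (hdepth : (P.horizon : ℝ) ≤ C * (W * κ))
    (hsparse : ∀ v, ({u | P.Member u v}.ncard : ℝ) ≤
      C * (κ * (Fintype.card V : ℝ) ^ (1 / (κ : ℝ)) * Real.log (Fintype.card V))) :
    ∃ (L : Finset ℕ) (𝒞 : L → Cluster P.net.graph),
      Represents P.net (fun v => outputOf (R P.rounds v) (P.net.ident v)) L 𝒞 ∧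
      IsSparseNeighborhoodCover C κ W 𝒞 := by
  -- A cluster is named by the identifier of its root; a nonempty cluster contains its root by
  -- `Member.root`.
  let L : Finset ℕ := (Finset.univ.filter fun u => P.Member u u).image P.net.ident
  have hL : ∀ i : L, ∃ u, P.Member u u ∧ P.net.ident u = i := by
    rintro ⟨i, hi⟩
    obtain ⟨u, hu, rfl⟩ := Finset.mem_image.1 hi
    exact ⟨u, (Finset.mem_filter.1 hu).2, rfl⟩
  choose root hroot hid using hL
  have hmemL : ∀ {u v}, P.Member u v → P.net.ident u ∈ L := fun {u v} h =>
    Finset.mem_image.2 ⟨u, Finset.mem_filter.2 ⟨Finset.mem_univ u, h.root⟩, rfl⟩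
  have hrid : ∀ {u} (h : P.net.ident u ∈ L), root ⟨P.net.ident u, h⟩ = u := fun {u} h =>
    P.net.ident.injective (hid ⟨P.net.ident u, h⟩)
  have hverts : ∀ i v, v ∈ (cluster (hroot i)).tree.verts ↔ P.Member (root i) v :=
    fun i v => Iff.rfl
  refine ⟨L, fun i => cluster (hroot i), ⟨?_, ?_, ?_⟩, ⟨?_, ?_, ?_⟩⟩
  · intro v l
    rw [hR.mem_clusters_iff]
    constructor
    · rintro ⟨u, rfl, hm⟩
      refine ⟨hmemL hm, ?_⟩
      rw [hverts, hrid]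
      exact hm
    · rintro ⟨h, hm⟩
      exact ⟨root ⟨l, h⟩, hid ⟨l, h⟩, hm⟩
  · intro i v hv x
    have hv' : P.Member (root i) v := hv
    rw [← hid i, hR.parent_eq_some_iff hv']
    simp only [isParent_cluster_iff]
    constructor
    · rintro ⟨h1, h2⟩
      exact ⟨_, h2, hv', h1, rfl⟩
    · rintro ⟨p, h2, -, h1, rfl⟩
      exact ⟨h1, h2⟩
  · intro i v hv x
    have hv' : P.Member (root i) v := hv
    rw [← hid i, hR.mem_children_iff hv']
    simp only [isParent_cluster_iff]
  · intro i
    exact le_trans (by exact_mod_cast cluster_depth_le (hroot i)) hdepth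
  · intro v
    refine le_trans ?_ (hsparse v)
    have : {i | v ∈ (cluster (hroot i)).tree.verts}.ncard ≤ {u | P.Member u v}.ncard := by
      refine Set.ncard_le_ncard_of_injOn root (fun i hi => hi) ?_ (Set.toFinite _)
      intro i _ j _ hij
      have := congrArg P.net.ident hij
      rw [hid, hid] at this
      exact Subtype.ext this
    exact_mod_cast this
  · intro v
    obtain ⟨u, hu⟩ := P.exists_ball_member v (m := P.slack / 2) (by omega)
    have hv : P.Member u v := hu v (by simp)
    refine ⟨⟨P.net.ident u, hmemL hv⟩, fun w hw => ?_⟩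
    rw [hverts, hrid]
    exact hu w (hW v w hw)

/-! ### The number of messages -/

theorem exists_sound {t : ℕ} (ht : t < P.rounds) : ∃ k, P.Sound (R t) k := by
  have hpos : 0 < P.phase := Nat.succ_pos _
  have hk : t / P.phase < P.horizon + 1 := (Nat.div_lt_iff_lt_mul hpos).2 ht
  have hj := Nat.mod_lt t hpos
  have hdm : t / P.phase * P.phase + t % P.phase = t := Nat.div_add_mod' t P.phase
  obtain ⟨h1, h2⟩ := hR.sound_and_complete (t / P.phase) hk.le
  by_cases h0 : t % P.phase = 0
  · rw [h0, add_zero] at hdm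
    rw [hdm] at h1
    exact ⟨_, h1⟩
  · have h3 := hR.later_slots (by omega) (hR.first_slot (by omega) h1 h2) (t % P.phase - 1) (by omega)
    rw [show t / P.phase * P.phase + (t % P.phase - 1 + 1) = t by omega] at h3
    exact ⟨_, h3.1⟩

-- Messages are charged to pairs (root, node): an invitation to the invited node, once in the whole
-- run; a message along a tree edge to the child, once upwards and once downwards per phase. This
-- makes `1 + 2 * (horizon + 1)` per pair.
open Classical in
theorem card_sends_le {B : ℕ}
    (hB : ∀ w, {u | P.arrival u w ≤ P.first w + P.slack + 2}.ncard ≤ B) :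
    (Finset.filter (fun p : ℕ × V × V => P.Sends (R p.1) p.1 p.2.1 p.2.2)
      (Finset.range P.rounds ×ˢ Finset.univ)).card ≤
      (2 * P.horizon + 3) * (B * Fintype.card V) := by
  have hpos : 0 < P.phase := Nat.succ_pos _
  have hdm : ∀ t, t / P.phase * P.phase + t % P.phase = t := fun t => Nat.div_add_mod' t P.phase
  have hkle : ∀ t, t < P.rounds → t / P.phase < P.horizon + 1 := fun t ht =>
    (Nat.div_lt_iff_lt_mul hpos).2 ht
  -- The `+ 2` admits invited nodes that never join: along the edge from a member `v` to `w` the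
  -- wave loses at most one, and `first v ≤ first w + 1`.
  let E : Finset (V × V) := Finset.univ.filter fun p => P.arrival p.1 p.2 ≤
    P.first p.2 + P.slack + 2
  have hE : E.card ≤ B * Fintype.card V := by
    refine Finset.card_le_mul_card_image_of_maps_to (f := Prod.snd) (t := Finset.univ)
      (fun _ _ => Finset.mem_univ _) B ?_
    intro w _
    refine le_trans ?_ (hB w)
    rw [← Set.ncard_coe_finset]
    refine Set.ncard_le_ncard_of_injOn Prod.fst ?_ ?_ (Set.toFinite _)
    · rintro ⟨u, w'⟩ h
      simp only [E, Finset.coe_filter, Finset.mem_filter, Finset.mem_univ, true_and] at h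
      obtain ⟨h1, rfl⟩ := h
      exact h1
    · rintro ⟨u, w1⟩ h1 ⟨u', w2⟩ h2 h
      simp only [Finset.coe_filter] at h1 h2
      exact Prod.ext h (h1.2.trans h2.2.symm)
  have hmemE : ∀ {u w}, P.Member u w → (u, w) ∈ E := fun {u w} h => by
    simp only [E, Finset.mem_filter, Finset.mem_univ, true_and]
    unfold Member at h
    omega
  let F : (ℕ × V × V → Prop) → Finset (ℕ × V × V) := fun q =>
    Finset.filter q (Finset.range P.rounds ×ˢ Finset.univ)
  have hF : ∀ {q : ℕ × V × V → Prop} {p}, p ∈ F q → p.1 < P.rounds ∧ q p := fun {q p} h => by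
    simpa [F] using h
  let q1 : ℕ × V × V → Prop := fun p => p.1 % P.phase = 0 ∧ ∃ f, Invites (R p.1 p.2.1)
    (p.1 / P.phase) f (P.net.ident p.2.2) ∧ f.node = P.net.ident p.2.1
  let q2 : ℕ × V × V → Prop := fun p => ∃ f ∈ R p.1 p.2.1, f.node = P.net.ident p.2.1 ∧
    f.parent = some (P.net.ident p.2.2) ∧ f.depth + p.1 % P.phase = P.horizon + 1
  let q3 : ℕ × V × V → Prop := fun p => ∃ f ∈ R p.1 p.2.1, f.node = P.net.ident p.2.2 ∧
    f.parent = some (P.net.ident p.2.1) ∧ p.1 % P.phase = P.horizon + f.depth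
  have hsub : Finset.filter (fun p : ℕ × V × V => P.Sends (R p.1) p.1 p.2.1 p.2.2)
      (Finset.range P.rounds ×ˢ Finset.univ) ⊆ F q1 ∪ (F q2 ∪ F q3) := by
    intro p hp
    rw [Finset.mem_filter] at hp
    simp only [F, Finset.mem_union, Finset.mem_filter]
    rcases hp.2 with h | h | h
    · exact Or.inl ⟨hp.1, h⟩
    · exact Or.inr (Or.inl ⟨hp.1, h⟩)
    · exact Or.inr (Or.inr ⟨hp.1, h⟩)
  have hinv : ∀ p ∈ F q1, p.1 / P.phase * P.phase = p.1 ∧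
      P.Sound (R p.1) (p.1 / P.phase) ∧ P.Complete (R p.1) (p.1 / P.phase) := by
    intro p hp
    obtain ⟨h1, h2, -⟩ := hF hp
    have h3 := hdm p.1
    rw [h2, add_zero] at h3
    have h4 := hR.sound_and_complete (p.1 / P.phase) (hkle _ h1).le
    rw [h3] at h4
    exact ⟨h3, h4⟩
  have h1 : (F q1).card ≤ E.card := by
    refine Finset.card_le_card_of_forall_subsingleton
      (fun p e => e.2 = p.2.2 ∧ P.Member e.1 p.2.1 ∧ P.arrival e.1 p.2.1 + 1 = p.1 / P.phase ∧
        P.net.graph.Adj p.2.1 p.2.2 ∧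
        Invites (R p.1 p.2.1) (p.1 / P.phase) (P.report e.1 p.2.1) (P.net.ident p.2.2)) ?_ ?_
    · rintro ⟨t, v, w⟩ hp
      obtain ⟨-, hs, -⟩ := hinv _ hp
      obtain ⟨-, -, f, hi, hf⟩ := hF hp
      obtain ⟨u, hm, ha, hadj, rfl⟩ := exists_of_invites hs hf hi
      refine ⟨(u, w), ?_, rfl, hm, ha, hadj, hi⟩
      simp only [E, Finset.mem_filter, Finset.mem_univ, true_and]
      have h5 : P.hop u w ≤ P.hop u v + 1 := P.hop_adj hadj
      have h6 : P.first v ≤ P.first w + 1 := P.first_adj hadj.symm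
      have hm' : P.arrival u v ≤ P.first v + P.slack := hm
      unfold arrival at *
      omega
    · rintro ⟨u, w⟩ - ⟨t, v, w1⟩ ⟨hp, hw1, hm, ha, hadj, hi⟩ ⟨t', v', w2⟩
        ⟨hp', hw2, hm', ha', hadj', hi'⟩
      simp only at hw1 hm ha hadj hi hw2 hm' ha' hadj' hi'
      subst hw1 hw2
      obtain ⟨ht, hs, hc⟩ := hinv _ hp
      obtain ⟨ht', hs', hc'⟩ := hinv _ hp'
      simp only at ht hs hc ht' hs' hc'
      -- Among the members next to `w` that joined before the current phase, an inviter is earliest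
      -- and, among the earliest, has the least identifier. Comparing two inviters both ways
      -- identifies them and their rounds.
      have key : ∀ {t : ℕ} {v v' : V}, P.Complete (R t) (t / P.phase) →
          P.Member u v → P.Member u v' → P.arrival u v + 1 = t / P.phase →
          P.arrival u v' < t / P.phase → P.net.graph.Adj v' w →
          Invites (R t v) (t / P.phase) (P.report u v) (P.net.ident w) →
          P.arrival u v ≤ P.arrival u v' ∧ P.net.ident v ≤ P.net.ident v' := by
        intro t v v' hc hm hm' ha ha' hadj hi
        exact (hi.2.2.2 _ (hc u v v' hm hm' (by omega) ha') rfl).2 (ident_mem_nbrIds.2 hadj)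
      have hkk : t / P.phase = t' / P.phase := by
        rcases lt_trichotomy (t / P.phase) (t' / P.phase) with h | h | h
        · have := (key hc' hm' hm ha' (by omega) hadj hi').1
          omega
        · exact h
        · have := (key hc hm hm' ha (by omega) hadj' hi).1
          omega
      have h7 := (key hc hm hm' ha (by omega) hadj' hi).2
      have h8 := (key hc' hm' hm ha' (by omega) hadj hi').2
      obtain rfl : v = v' := P.net.ident.injective (le_antisymm h7 h8)
      rw [hkk] at ht
      obtain rfl : t = t' := ht.symm.trans ht'
      rfl
  -- The phase, the root and the child determine the message, since the depth of the child fixes the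
  -- slot; likewise for `q3`.
  have h2 : (F q2).card ≤ (Finset.range (P.horizon + 1) ×ˢ E).card := by
    refine Finset.card_le_card_of_forall_subsingleton
      (fun p e => e.1 = p.1 / P.phase ∧ e.2.2 = p.2.1 ∧ P.par e.2.1 p.2.1 = p.2.2 ∧
        P.hop e.2.1 p.2.1 + p.1 % P.phase = P.horizon + 1) ?_ ?_
    · rintro ⟨t, v, w⟩ hp
      obtain ⟨ht, f, hf, hn, hpar, hd⟩ := hF hp
      obtain ⟨k, hs⟩ := hR.exists_sound ht
      obtain ⟨u, v', hm, -, rfl⟩ := hs v f hf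
      obtain rfl : v' = v := P.net.ident.injective hn
      exact ⟨(t / P.phase, u, v'), Finset.mem_product.2 ⟨Finset.mem_range.2 (hkle t ht), hmemE hm⟩,
        rfl, rfl, P.net.ident.injective (parent_report.1 hpar).2, hd⟩
    · rintro ⟨k, u, v⟩ - ⟨t, v1, w1⟩ ⟨-, hk, hv, hw, hd⟩ ⟨t', v2, w2⟩ ⟨-, hk', hv', hw', hd'⟩
      simp only at hk hv hw hd hk' hv' hw' hd'
      subst hv hv' hw hw'
      have h3 := hdm t
      have h4 := hdm t'
      rw [← hk] at h3
      rw [← hk'] at h4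
      obtain rfl : t = t' := by omega
      rfl
  have h3 : (F q3).card ≤ (Finset.range (P.horizon + 1) ×ˢ E).card := by
    refine Finset.card_le_card_of_forall_subsingleton
      (fun p e => e.1 = p.1 / P.phase ∧ e.2.2 = p.2.2 ∧ P.par e.2.1 p.2.2 = p.2.1 ∧
        p.1 % P.phase = P.horizon + P.hop e.2.1 p.2.2) ?_ ?_
    · rintro ⟨t, v, w⟩ hp
      obtain ⟨ht, f, hf, hn, hpar, hd⟩ := hF hp
      obtain ⟨k, hs⟩ := hR.exists_sound ht
      obtain ⟨u, w', hm, -, rfl⟩ := hs v f hf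
      obtain rfl : w' = w := P.net.ident.injective hn
      exact ⟨(t / P.phase, u, w'), Finset.mem_product.2 ⟨Finset.mem_range.2 (hkle t ht), hmemE hm⟩,
        rfl, rfl, P.net.ident.injective (parent_report.1 hpar).2, hd⟩
    · rintro ⟨k, u, v⟩ - ⟨t, v1, w1⟩ ⟨-, hk, hv, hw, hd⟩ ⟨t', v2, w2⟩ ⟨-, hk', hv', hw', hd'⟩
      simp only at hk hv hw hd hk' hv' hw' hd'
      subst hv hv' hw hw'
      have h3 := hdm t
      have h4 := hdm t'
      rw [← hk] at h3
      rw [← hk'] at h4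
      obtain rfl : t = t' := by omega
      rfl
  rw [Finset.card_product, Finset.card_range] at h2 h3
  have h4 : (P.horizon + 1) * E.card ≤ (P.horizon + 1) * (B * Fintype.card V) :=
    Nat.mul_le_mul_left _ hE
  calc _ ≤ _ := Finset.card_le_card hsub
    _ ≤ (F q1).card + ((F q2).card + (F q3).card) :=
        (Finset.card_union_le _ _).trans (Nat.add_le_add_left (Finset.card_union_le _ _) _)
    _ ≤ B * Fintype.card V + ((P.horizon + 1) * (B * Fintype.card V) +
          (P.horizon + 1) * (B * Fintype.card V)) := by omega
    _ = _ := by ring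

end Evolves

theorem messages_le {H slack delay : LocalInput → ℕ} {κ W : ℕ} {ω : V → I}
    (hP : P.Computes H slack delay κ W ω) {B : ℕ}
    (hB : ∀ w, {u | P.arrival u w ≤ P.first w + P.slack + 2}.ncard ≤ B) :
    (waveAlgorithm H slack delay).messages P.net κ W ω P.rounds ≤
      (2 * P.horizon + 3) * (B * Fintype.card V) := by
  classical
  refine le_trans ?_ ((evolves hP).card_sends_le hB)
  rw [Finset.card_filter, Finset.sum_product]
  refine Finset.sum_le_sum fun t ht => ?_
  rw [← Finset.card_filter]
  refine Finset.card_le_card fun p hp => ?_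
  rw [Finset.mem_filter] at hp ⊢
  obtain ⟨m, hm⟩ := Option.isSome_iff_exists.1 hp.2.2
  exact ⟨Finset.mem_univ p, ((emit_eq_some_iff hP t (Finset.mem_range.1 ht) p.1 p.2 m).1 hm).1⟩

end Wave

/-! ### The parameters -/

/-- The time in which a random delay decreases the probability by the factor `n`. -/
def waveScale (n κ W : ℕ) : ℕ := 5 * (min κ n * min W n)

/-- The largest delay. -/
def waveCap (c n κ W : ℕ) : ℕ := waveScale n κ W * (c + 2)

/-- The ratio of the geometric distribution of the delays. -/
def waveRatio (n κ W : ℕ) : ℝ := (n : ℝ) ^ (-(1 / (waveScale n κ W : ℝ)))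

/-- By how much the wave of a node with seed `r` starts before the latest possible time. -/
def waveShift (c n κ W : ℕ) (r : I) : ℕ :=
  open Classical in Nat.findGreatest (fun m => (r : ℝ) ≤ waveRatio n κ W ^ m) (waveCap c n κ W)

/-- The waves with random delays. -/
def randomWave {V : Type u} [Fintype V] (c : ℕ) (N : Network V) (κ W : ℕ) (ω : V → I) : Wave V where
  net := N
  delay v := waveCap c (Fintype.card V) κ W - waveShift c (Fintype.card V) κ W (ω v)
  cap := waveCap c (Fintype.card V) κ W
  slack := 2 * min W (Fintype.card V)
  delay_le _ := Nat.sub_le _ _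

/-- The algorithm that constructs a sparse neighborhood cover. -/
def coverAlgorithm (c : ℕ) : DistAlgorithm :=
  waveAlgorithm (fun a => waveCap c a.n a.κ a.W + 2 * min a.W a.n) (fun a => 2 * min a.W a.n)
    (fun a => waveCap c a.n a.κ a.W - waveShift c a.n a.κ a.W a.seed)

theorem randomWave_computes {V : Type u} [Fintype V] (c : ℕ) (N : Network V) (κ W : ℕ) (ω : V → I) :
    (randomWave c N κ W ω).Computes (fun a => waveCap c a.n a.κ a.W + 2 * min a.W a.n)
      (fun a => 2 * min a.W a.n)
      (fun a => waveCap c a.n a.κ a.W - waveShift c a.n a.κ a.W a.seed) κ W ω where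
  horizon_eq _ := rfl
  slack_eq _ := rfl
  delay_eq _ := rfl

section Ratio

variable {n κ W : ℕ}

theorem waveScale_pos (hn : 2 ≤ n) (hκ : 1 ≤ κ) (hW : 1 ≤ W) : 0 < waveScale n κ W := by
  have h1 : 0 < min κ n := by omega
  have h2 : 0 < min W n := by omega
  unfold waveScale
  positivity

theorem waveRatio_pos (hn : 2 ≤ n) : 0 < waveRatio n κ W :=
  Real.rpow_pos_of_pos (by positivity) _

theorem waveRatio_le_one (hn : 2 ≤ n) : waveRatio n κ W ≤ 1 := by
  apply Real.rpow_le_one_of_one_le_of_nonpos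
  · exact_mod_cast (by omega : 1 ≤ n)
  · rw [neg_nonpos]; positivity

/-- This bounds the probability that truncation at the cap matters at a given node; the exponent `c
+ 2` leaves `n^(-(c+1))` after a union bound over the nodes. -/
theorem waveRatio_pow_cap (c : ℕ) (hn : 2 ≤ n) (hκ : 1 ≤ κ) (hW : 1 ≤ W) :
    waveRatio n κ W ^ waveCap c n κ W = ((n : ℝ) ^ (c + 2))⁻¹ := by
  have hs : (waveScale n κ W : ℝ) ≠ 0 := by exact_mod_cast (waveScale_pos hn hκ hW).ne'
  have h : waveRatio n κ W ^ waveScale n κ W = (n : ℝ)⁻¹ := by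
    rw [waveRatio, ← Real.rpow_natCast, ← Real.rpow_mul (by positivity), neg_mul,
      one_div_mul_cancel hs, Real.rpow_neg_one]
  rw [waveCap, pow_mul, h, inv_pow]

/-- The factor 5 in `waveScale` is there because `2 * m + 3 ≤ 5 * m` for `m = min W n ≥ 1`; the
factor 2 pays for replacing `κ` by `n` when `κ > n`, as `n^(1/n) ≤ 2`. -/
theorem le_waveRatio_pow (hn : 2 ≤ n) (hκ : 1 ≤ κ) (hW : 1 ≤ W) :
    (2 * (n : ℝ) ^ (1 / (κ : ℝ)))⁻¹ ≤ waveRatio n κ W ^ (2 * min W n + 3) := by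
  have hn0 : (0 : ℝ) < n := by positivity
  have hn1 : (1 : ℝ) ≤ n := by exact_mod_cast (by omega : 1 ≤ n)
  have hk : 0 < min κ n := by omega
  have hw : 0 < min W n := by omega
  have h1 : waveRatio n κ W ^ (5 * min W n) = ((n : ℝ) ^ (1 / ((min κ n : ℕ) : ℝ)))⁻¹ := by
    have hk' : ((min κ n : ℕ) : ℝ) ≠ 0 := by exact_mod_cast hk.ne'
    have hw' : ((min W n : ℕ) : ℝ) ≠ 0 := by exact_mod_cast hw.ne'
    rw [waveRatio, ← Real.rpow_natCast, ← Real.rpow_mul hn0.le, ← Real.rpow_neg hn0.le]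
    congr 1
    unfold waveScale
    rw [Nat.cast_mul, Nat.cast_mul, Nat.cast_mul]
    field_simp
  have h2 : (n : ℝ) ^ (1 / ((min κ n : ℕ) : ℝ)) ≤ 2 * (n : ℝ) ^ (1 / (κ : ℝ)) := by
    have hy : (1 : ℝ) ≤ (n : ℝ) ^ (1 / (κ : ℝ)) := Real.one_le_rpow hn1 (by positivity)
    rcases le_total κ n with h | h
    · rw [min_eq_left h]; linarith
    · rw [min_eq_right h]
      have : (n : ℝ) ^ (1 / (n : ℝ)) ≤ 2 := by
        have h3 : (n : ℝ) ≤ 2 ^ n := by exact_mod_cast n.lt_two_pow_self.le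
        calc (n : ℝ) ^ (1 / (n : ℝ)) ≤ ((2 : ℝ) ^ n) ^ (1 / (n : ℝ)) :=
              Real.rpow_le_rpow hn0.le h3 (by positivity)
          _ = 2 := by
              rw [← Real.rpow_natCast, ← Real.rpow_mul (by norm_num), mul_one_div_cancel hn0.ne',
                Real.rpow_one]
      linarith
  calc (2 * (n : ℝ) ^ (1 / (κ : ℝ)))⁻¹ ≤ ((n : ℝ) ^ (1 / ((min κ n : ℕ) : ℝ)))⁻¹ :=
        inv_anti₀ (by positivity) h2
    _ = waveRatio n κ W ^ (5 * min W n) := h1.symm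
    _ ≤ _ := pow_le_pow_of_le_one (waveRatio_pos hn).le (waveRatio_le_one hn) (by omega)

/-- The left side counts the possible times of a first arrival, for a union bound. It is polynomial
in `n` because `κ` and `W` are cut off at `n`. -/
theorem waveCap_add_one_le (c : ℕ) (hn : 2 ≤ n) : waveCap c n κ W + 1 ≤ n ^ (c + 6) := by
  have h1 : waveCap c n κ W ≤ 5 * (n * n) * (c + 2) :=
    Nat.mul_le_mul_right _ (Nat.mul_le_mul_left _
      (Nat.mul_le_mul (min_le_right _ _) (min_le_right _ _)))
  have h2 : 5 * c + 11 ≤ 2 ^ (c + 4) := by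
    have := c.lt_two_pow_self
    have h3 : 1 ≤ 2 ^ c := Nat.one_le_two_pow
    rw [pow_add]
    omega
  have h3 : 2 ^ (c + 4) ≤ n ^ (c + 4) := Nat.pow_le_pow_left hn _
  have h4 : 1 ≤ n * n := Nat.mul_pos (by omega) (by omega)
  calc waveCap c n κ W + 1 ≤ (5 * c + 11) * (n * n) := by nlinarith
    _ ≤ n ^ (c + 4) * (n * n) := Nat.mul_le_mul_right _ (h2.trans h3)
    _ = n ^ (c + 6) := by ring

/-- As soon as the seed is not exceptionally small, the shift is geometrically distributed. -/
theorem le_waveShift_iff {c : ℕ} (hn : 2 ≤ n) {r : I}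
    (hr : waveRatio n κ W ^ waveCap c n κ W < (r : ℝ)) (m : ℕ) :
    m ≤ waveShift c n κ W r ↔ (r : ℝ) ≤ waveRatio n κ W ^ m := by
  classical
  have hanti : ∀ {i j : ℕ}, i ≤ j → waveRatio n κ W ^ j ≤ waveRatio n κ W ^ i := fun h =>
    pow_le_pow_of_le_one (waveRatio_pos hn).le (waveRatio_le_one hn) h
  constructor
  · intro h
    have h0 : (r : ℝ) ≤ waveRatio n κ W ^ 0 := by rw [pow_zero]; exact r.2.2
    have := Nat.findGreatest_spec (P := fun m => (r : ℝ) ≤ waveRatio n κ W ^ m)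
      (Nat.zero_le (waveCap c n κ W)) h0
    exact this.trans (hanti (by unfold waveShift at h; convert h))
  · intro h
    have hle : m ≤ waveCap c n κ W := by
      by_contra hlt
      exact absurd (h.trans (hanti (not_le.1 hlt).le)) (not_le.2 hr)
    have := Nat.le_findGreatest (P := fun m => (r : ℝ) ≤ waveRatio n κ W ^ m) hle h
    unfold waveShift
    convert this

theorem waveShift_le (c : ℕ) (r : I) : waveShift c n κ W r ≤ waveCap c n κ W :=
  Nat.findGreatest_le _

end Ratio

/-! ### The sparsity of the clusters -/

/-- The bound for the number of waves that arrive at a node soon after the first one. -/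
def waveBound (c n κ : ℕ) : ℕ :=
  ⌈(2 * c + 8) * Real.log n * (2 * (n : ℝ) ^ (1 / (κ : ℝ)))⌉₊

theorem waveBound_le {c n κ : ℕ} (hn : 2 ≤ n) : (waveBound c n κ : ℝ) ≤
    (4 * c + 18) * ((n : ℝ) ^ (1 / (κ : ℝ)) * Real.log n) := by
  have hn1 : (1 : ℝ) ≤ n := by exact_mod_cast (by omega : 1 ≤ n)
  have hy : (1 : ℝ) ≤ (n : ℝ) ^ (1 / (κ : ℝ)) := Real.one_le_rpow hn1 (by positivity)
  have hlog : (1 / 2 : ℝ) ≤ Real.log n := by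
    have h1 : Real.log 2 ≤ Real.log n := Real.log_le_log (by norm_num) (by exact_mod_cast hn)
    have h2 := Real.log_two_gt_d9
    linarith
  have h := (Nat.ceil_lt_add_one (a := (2 * c + 8) * Real.log n * (2 * (n : ℝ) ^ (1 / (κ : ℝ))))
    (by positivity)).le
  -- This absorbs the `+ 1` of the ceiling and turns `4c + 16` into `4c + 18`.
  have h1 : (1 : ℝ) ≤ 2 * ((n : ℝ) ^ (1 / (κ : ℝ)) * Real.log n) := by nlinarith
  unfold waveBound
  linarith

/-- Since `1 - ρ ≤ exp (-ρ)`, it suffices that `waveBound` is large enough for `ρ * waveBound ≥ (2c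
+ 8) log n`. -/
theorem one_sub_pow_waveBound_le {c n κ : ℕ} (hn : 2 ≤ n) {ρ : ℝ} (hρ1 : ρ ≤ 1)
    (hρ : (2 * (n : ℝ) ^ (1 / (κ : ℝ)))⁻¹ ≤ ρ) :
    (1 - ρ) ^ waveBound c n κ ≤ ((n : ℝ) ^ (2 * c + 8))⁻¹ := by
  have hn0 : (0 : ℝ) < n := by positivity
  have hy : (0 : ℝ) < 2 * (n : ℝ) ^ (1 / (κ : ℝ)) := by positivity
  have hB : (2 * c + 8) * Real.log n * (2 * (n : ℝ) ^ (1 / (κ : ℝ))) ≤ waveBound c n κ :=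
    Nat.le_ceil _
  have h1 : (2 * c + 8) * Real.log n ≤ ρ * waveBound c n κ := by
    calc (2 * c + 8) * Real.log n = (2 * (n : ℝ) ^ (1 / (κ : ℝ)))⁻¹ *
          ((2 * c + 8) * Real.log n * (2 * (n : ℝ) ^ (1 / (κ : ℝ)))) := by field_simp
      _ ≤ (2 * (n : ℝ) ^ (1 / (κ : ℝ)))⁻¹ * waveBound c n κ :=
          mul_le_mul_of_nonneg_left hB (by positivity)
      _ ≤ _ := mul_le_mul_of_nonneg_right hρ (by positivity)
  calc (1 - ρ) ^ waveBound c n κ ≤ Real.exp (-ρ) ^ waveBound c n κ :=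
        pow_le_pow_left₀ (by linarith) (Real.one_sub_le_exp_neg ρ) _
    _ = Real.exp (-(ρ * waveBound c n κ)) := by rw [← Real.exp_nat_mul]; congr 1; ring
    _ ≤ Real.exp (-((2 * c + 8) * Real.log n)) := Real.exp_le_exp.2 (by linarith)
    _ = ((n : ℝ) ^ (2 * c + 8))⁻¹ := by
        rw [Real.exp_neg, ← Real.exp_log (pow_pos hn0 (2 * c + 8)), Real.log_pow]
        push_cast
        rfl

theorem volume_seed_le {V : Type u} [Fintype V] (v : V) (x : ℝ) :
    (volume : Measure (V → I)) {ω | (ω v : ℝ) ≤ x} ≤ ENNReal.ofReal x := by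
  classical
  have h1 : {ω : V → I | (ω v : ℝ) ≤ x} =
      Set.pi Set.univ (fun u => if u = v then {r : I | (r : ℝ) ≤ x} else Set.univ) := by
    ext ω
    constructor
    · intro h u _
      by_cases hu : u = v
      · subst hu; simpa using h
      · simp [hu]
    · intro h
      simpa using h v (Set.mem_univ v)
  have h2 : ∀ u, (volume : Measure I) (if u = v then {r : I | (r : ℝ) ≤ x} else Set.univ) =
      if u = v then (volume : Measure I) {r : I | (r : ℝ) ≤ x} else 1 := by
    intro u
    split_ifs
    · rfl
    · exact measure_univ
  rw [h1, volume_pi_pi]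
  simp only [h2]
  rw [Finset.prod_ite_eq' Finset.univ v, if_pos (Finset.mem_univ v), unitInterval.volume_apply]
  have h3 : Subtype.val '' {r : I | (r : ℝ) ≤ x} ⊆ Set.Icc 0 x := by
    rintro _ ⟨r, hr, rfl⟩
    exact ⟨r.2.1, hr⟩
  exact (measure_mono h3).trans (by rw [Real.volume_Icc, sub_zero])

/-- With high probability, only few waves arrive at a node soon after the first one. -/
theorem volume_not_sparse_le {V : Type u} [Fintype V] (c : ℕ) (N : Network V) {κ W : ℕ}
    (hκ : 1 ≤ κ) (hW : 1 ≤ W) (hn : 2 ≤ Fintype.card V) :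
    (volume : Measure (V → I)) {ω | ¬ ∀ w, {u | (randomWave c N κ W ω).arrival u w ≤
        (randomWave c N κ W ω).first w + (randomWave c N κ W ω).slack + 2}.ncard ≤
        waveBound c (Fintype.card V) κ} ≤ 1 / (Fintype.card V : ℝ≥0∞) ^ c := by
  set n := Fintype.card V with hndef
  set q := waveRatio n κ W with hq
  set cap := waveCap c n κ W with hcap
  set B := waveBound c n κ with hBdef
  have hq0 : 0 < q := waveRatio_pos hn
  have hq1 : q ≤ 1 := waveRatio_le_one hn
  -- Hop counts do not depend on the seeds, so any seeds serve here.
  let hop : V → V → ℕ := (randomWave c N κ W fun _ => 0).hop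
  let s := 2 * min W n + 2
  -- For seeds above `q ^ cap` and `a ≤ cap`, this says that at least `B` waves reach `w` by time `a
  -- + s`, but none before `a`; the exponents differ by at most `s + 1`. If the first subtraction
  -- truncates to 0, the threshold is 1, which every seed meets.
  let E : V → ℕ → Set (V → I) := fun w a => {ω |
    B ≤ {u | (ω u : ℝ) ≤ q ^ (cap + hop u w - (a + s))}.ncard ∧
      ∀ u, q ^ (cap + hop u w + 1 - a) < (ω u : ℝ)}
  have hsub : {ω | ¬ ∀ w, {u | (randomWave c N κ W ω).arrival u w ≤
        (randomWave c N κ W ω).first w + (randomWave c N κ W ω).slack + 2}.ncard ≤ B} ⊆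
      (⋃ v ∈ (Finset.univ : Finset V), {ω | (ω v : ℝ) ≤ q ^ cap}) ∪
      ⋃ w ∈ (Finset.univ : Finset V), ⋃ a ∈ Finset.range (cap + 1), E w a := by
    intro ω hω
    by_contra hnot
    apply hω
    intro w
    simp only [Set.mem_union, Set.mem_iUnion, Finset.mem_univ, exists_true_left, not_or,
      not_exists, Finset.mem_range, Set.mem_ofPred_eq, not_le] at hnot
    obtain ⟨h1, h2⟩ := hnot
    have harr : ∀ u, (randomWave c N κ W ω).arrival u w =
        cap - waveShift c n κ W (ω u) + hop u w := fun u => rfl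
    have hfirst : (randomWave c N κ W ω).first w ≤ cap := Wave.first_le_cap _ w
    have h3 := h2 w ((randomWave c N κ W ω).first w) (by omega)
    have hset : {u | (ω u : ℝ) ≤ q ^ (cap + hop u w - ((randomWave c N κ W ω).first w + s))} =
        {u | (randomWave c N κ W ω).arrival u w ≤
          (randomWave c N κ W ω).first w + (randomWave c N κ W ω).slack + 2} := by
      ext u
      simp only [Set.mem_ofPred_eq, harr]
      rw [← le_waveShift_iff hn (h1 u)]
      have := waveShift_le (n := n) (κ := κ) (W := W) c (ω u)
      change _ ↔ _ ≤ _ + 2 * min W n + 2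
      simp only [s]
      omega
    rw [← hset]
    by_contra hlt
    refine h3 ⟨(not_le.1 hlt).le, fun u => ?_⟩
    by_contra hle
    rw [not_lt, ← le_waveShift_iff hn (h1 u)] at hle
    have h4 := Wave.first_le (randomWave c N κ W ω) u w
    rw [harr] at h4
    have := waveShift_le (n := n) (κ := κ) (W := W) c (ω u)
    omega
  have hE : ∀ w a, (volume : Measure (V → I)) (E w a) ≤
      ENNReal.ofReal ((n : ℝ) ^ (2 * c + 8))⁻¹ := by
    intro w a
    have hanti : ∀ {i j : ℕ}, i ≤ j → q ^ j ≤ q ^ i := fun h =>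
      pow_le_pow_of_le_one hq0.le hq1 h
    refine (volume_many_le_none_le (fun u => q ^ (cap + hop u w - (a + s)))
      (fun u => q ^ (cap + hop u w + 1 - a)) (q ^ (2 * min W n + 3)) (by positivity)
      (pow_le_one₀ hq0.le hq1) (fun u => pow_le_one₀ hq0.le hq1) (fun u => by positivity)
      (fun u => hanti (by omega)) (fun u => ?_) B).trans ?_
    · rw [← pow_add]
      exact hanti (by simp only [s]; omega)
    · exact ENNReal.ofReal_le_ofReal (one_sub_pow_waveBound_le hn (pow_le_one₀ hq0.le hq1)
        (le_waveRatio_pow hn hκ hW))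
  have hn0 : (0 : ℝ) < n := by positivity
  -- Both summands are at most `n^(-(c+1))`, and `2 / n ≤ 1`.
  have hreal : (n : ℝ) * ((n : ℝ) ^ (c + 2))⁻¹ +
      n * ((cap + 1 : ℕ) * ((n : ℝ) ^ (2 * c + 8))⁻¹) ≤ 1 / (n : ℝ) ^ c := by
    have h1 : ((cap + 1 : ℕ) : ℝ) ≤ (n : ℝ) ^ (c + 6) := by
      exact_mod_cast waveCap_add_one_le c hn
    have h2 : (2 : ℝ) ≤ n := by exact_mod_cast hn
    calc _ ≤ (n : ℝ) * ((n : ℝ) ^ (c + 2))⁻¹ +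
          n * ((n : ℝ) ^ (c + 6) * ((n : ℝ) ^ (2 * c + 8))⁻¹) := by gcongr
      _ = (2 / n) * (1 / (n : ℝ) ^ c) := by
          rw [show 2 * c + 8 = (c + 6) + (c + 2) by ring]
          simp only [pow_add]
          field_simp
          ring
      _ ≤ 1 * (1 / (n : ℝ) ^ c) := by
          gcongr
          rw [div_le_one hn0]
          exact h2
      _ = _ := one_mul _
  calc _ ≤ _ := measure_mono hsub
    _ ≤ (∑ v : V, (volume : Measure (V → I)) {ω | (ω v : ℝ) ≤ q ^ cap}) +
        ∑ w : V, ∑ a ∈ Finset.range (cap + 1), (volume : Measure (V → I)) (E w a) := by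
        refine (measure_union_le _ _).trans (add_le_add (measure_biUnion_finset_le _ _) ?_)
        refine (measure_biUnion_finset_le _ _).trans (Finset.sum_le_sum fun w _ => ?_)
        exact measure_biUnion_finset_le _ _
    _ ≤ (∑ v : V, ENNReal.ofReal ((n : ℝ) ^ (c + 2))⁻¹) +
        ∑ w : V, ∑ a ∈ Finset.range (cap + 1), ENNReal.ofReal ((n : ℝ) ^ (2 * c + 8))⁻¹ := by
        refine add_le_add (Finset.sum_le_sum fun v _ => ?_)
          (Finset.sum_le_sum fun w _ => Finset.sum_le_sum fun a _ => hE w a)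
        rw [← waveRatio_pow_cap c hn hκ hW]
        exact volume_seed_le v _
    _ = ENNReal.ofReal ((n : ℝ) * ((n : ℝ) ^ (c + 2))⁻¹ +
          n * ((cap + 1 : ℕ) * ((n : ℝ) ^ (2 * c + 8))⁻¹)) := by
        simp only [Finset.sum_const, Finset.card_univ, Finset.card_range, nsmul_eq_mul]
        rw [ENNReal.ofReal_add (by positivity) (by positivity),
          ENNReal.ofReal_mul (by positivity), ENNReal.ofReal_mul (by positivity),
          ENNReal.ofReal_mul (by positivity), ENNReal.ofReal_natCast, ENNReal.ofReal_natCast]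
    _ ≤ ENNReal.ofReal (1 / (n : ℝ) ^ c) := ENNReal.ofReal_le_ofReal hreal
    _ = _ := by
        rw [ENNReal.ofReal_div_of_pos (by positivity), ENNReal.ofReal_one,
          ENNReal.ofReal_pow hn0.le, ENNReal.ofReal_natCast]

/-- Distances are infinite or at most the number of vertices. -/
theorem edist_le_min_card {V : Type u} [Fintype V] (G : SimpleGraph V) {v w : V} {W : ℕ}
    (h : G.edist v w ≤ W) : G.edist v w ≤ (min W (Fintype.card V) : ℕ) := by
  classical
  rcases le_total W (Fintype.card V) with hW | hW
  · rwa [min_eq_left hW]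
  · rw [min_eq_right hW]
    have hr : G.Reachable v w := by
      apply SimpleGraph.edist_ne_top_iff_reachable.1
      intro h'
      rw [h'] at h
      exact absurd h (by simp)
    obtain ⟨p, hp⟩ := hr.exists_isPath
    exact (SimpleGraph.edist_le p).trans (by exact_mod_cast hp.length_lt.le)

end

/-! ### Assembling the bounds -/

theorem mainTheorem3 (c : ℕ) :
    ∃ (A : DistAlgorithm) (C : ℝ), 0 < C ∧
      ∀ (κ W : ℕ), 1 ≤ κ → 1 ≤ W →
      ∀ (V : Type u) [Fintype V] (N : Network V), 2 ≤ Fintype.card V →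
      ∃ T : ℕ, (T : ℝ) ≤ C * ((κ : ℝ) ^ 3 * (W : ℝ) ^ 2) ∧
        (∀ ω : V → I, A.TerminatesBy N κ W ω T) ∧
        (volume : Measure (V → I))
          {ω | ¬ (A.ConstructsCover N C κ W ω T ∧
            (A.messages N κ W ω T : ℝ) ≤
              C * (Fintype.card V * κ * (Fintype.card V : ℝ) ^ (1 / (κ : ℝ)) *
                Real.log (Fintype.card V) * (κ * W)))} ≤
          1 / (Fintype.card V : ℝ≥0∞) ^ c := by
  -- One constant serves all bounds: `5c + 12` bounds the horizon relative to `κW`, `4c + 18` comes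
  -- from `waveBound_le`, and 6 from `(H + 1)(2H + 1) ≤ 2x * 3x`.
  refine ⟨coverAlgorithm c, 6 * (5 * c + 12) ^ 2 * (4 * c + 18), by positivity, ?_⟩
  intro κ W hκ hW V _ N hn
  set n := Fintype.card V with hndef
  set H := waveCap c n κ W + 2 * min W n with hH
  have hκ1 : (1 : ℝ) ≤ κ := by exact_mod_cast hκ
  have hW1 : (1 : ℝ) ≤ W := by exact_mod_cast hW
  have hκW : (1 : ℝ) ≤ κ * W := by nlinarith
  have hc0 : (0 : ℝ) ≤ c := Nat.cast_nonneg c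
  have hHle : (H : ℝ) ≤ (5 * c + 12) * (κ * W) := by
    have h1 : H ≤ 5 * (κ * W) * (c + 2) + 2 * (κ * W) := by
      refine add_le_add (Nat.mul_le_mul_right _ (Nat.mul_le_mul_left _
        (Nat.mul_le_mul (min_le_left _ _) (min_le_left _ _)))) (Nat.mul_le_mul_left _ ?_)
      exact (min_le_left _ _).trans (Nat.le_mul_of_pos_left _ hκ)
    calc (H : ℝ) ≤ ((5 * (κ * W) * (c + 2) + 2 * (κ * W) : ℕ) : ℝ) := by exact_mod_cast h1
      _ = _ := by push_cast; ring
  set x : ℝ := (5 * c + 12) * (κ * W) with hx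
  have hx1 : 1 ≤ x := by rw [hx]; nlinarith
  have hrounds : ∀ ω, (randomWave c N κ W ω).rounds = (H + 1) * (2 * H + 1) := fun ω => rfl
  have hn1 : (1 : ℝ) ≤ n := by exact_mod_cast (by omega : 1 ≤ n)
  set L : ℝ := (n : ℝ) ^ (1 / (κ : ℝ)) * Real.log n with hL
  have hL0 : 0 ≤ L := mul_nonneg (by positivity) (Real.log_nonneg hn1)
  have hB : (waveBound c n κ : ℝ) ≤ (4 * c + 18) * L := waveBound_le hn
  refine ⟨(H + 1) * (2 * H + 1), ?_, ?_, ?_⟩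
  · push_cast
    have hH0 : (0 : ℝ) ≤ H := Nat.cast_nonneg H
    calc ((H : ℝ) + 1) * (2 * H + 1) ≤ (2 * x) * (3 * x) :=
          mul_le_mul (by linarith) (by linarith) (by positivity) (by linarith)
      _ = 6 * (5 * c + 12) ^ 2 * 1 * (κ ^ 2 * 1 * W ^ 2) := by rw [hx]; ring
      _ ≤ 6 * (5 * c + 12) ^ 2 * (4 * c + 18) * (κ ^ 2 * κ * W ^ 2) := by
          gcongr
          linarith
      _ = _ := by ring
  · intro ω v
    have h := Wave.output_run (randomWave_computes c N κ W ω) v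
    rw [hrounds] at h
    exact Option.isSome_iff_exists.2 ⟨_, h⟩
  -- A failure of the cover or of the message bound forces too many early waves at some node;
  -- everything else holds for all seeds.
  · refine (measure_mono ?_).trans (volume_not_sparse_le c N hκ hW hn)
    intro ω hω hsp
    apply hω
    have hP := randomWave_computes c N κ W ω
    constructor
    · have hcover := (Wave.evolves hP).exists_represents
        (6 * (5 * c + 12) ^ 2 * (4 * c + 18)) (κ := κ) (W := W) ?_ ?_ ?_
      · obtain ⟨S, 𝒞, h1, h2⟩ := hcover
        refine ⟨_, S, 𝒞, fun v => ?_, h1, h2⟩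
        have h := Wave.output_run hP v
        rwa [hrounds] at h
      · intro v w hvw
        have : (randomWave c N κ W ω).slack / 2 = min W n :=
          Nat.mul_div_cancel_left _ (by norm_num)
        rw [this]
        exact edist_le_min_card _ hvw
      · calc ((randomWave c N κ W ω).horizon : ℝ) ≤ x := hHle
          _ ≤ (6 * (5 * c + 12) * (4 * c + 18)) * x := le_mul_of_one_le_left (by linarith)
              (by nlinarith)
          _ = _ := by rw [hx]; ring
      · intro v
        have h1 : {u | (randomWave c N κ W ω).Member u v}.ncard ≤ waveBound c n κ := by
          refine le_trans (Set.ncard_le_ncard (fun u hu => ?_) (Set.toFinite _)) (hsp v)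
          exact le_trans hu (Nat.le_add_right _ 2)
        calc (({u | (randomWave c N κ W ω).Member u v}.ncard : ℕ) : ℝ) ≤ waveBound c n κ := by
              exact_mod_cast h1
          _ ≤ (1 * (4 * c + 18)) * (1 * L) := by linarith
          _ ≤ (6 * (5 * c + 12) ^ 2 * (4 * c + 18)) * (κ * L) := by
              gcongr
              nlinarith
          _ = _ := by rw [hL]; ring
    · have h1 := Wave.messages_le hP hsp
      rw [hrounds] at h1
      have h2 : ((coverAlgorithm c).messages N κ W ω ((H + 1) * (2 * H + 1)) : ℝ) ≤
          ((2 * H + 3) * (waveBound c n κ * n) : ℕ) := by exact_mod_cast h1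
      refine h2.trans ?_
      push_cast
      calc (2 * (H : ℝ) + 3) * (waveBound c n κ * n) ≤ (5 * x) * ((4 * c + 18) * L * n) := by
            gcongr
            linarith
        _ = (5 * (5 * c + 12) * (4 * c + 18)) * (n * 1 * L * (κ * W)) := by rw [hx]; ring
        _ ≤ (6 * (5 * c + 12) ^ 2 * (4 * c + 18)) * (n * κ * L * (κ * W)) := by
            gcongr
            · norm_num
            · nlinarith
        _ = _ := by rw [hL]; ring
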